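/- Let $D$ be a division ring, finite-dimensional over its center $C$, of prime characteristic $p$. Let $\delta$ be a derivation of $D$, $F=\{x\in C:\delta(x)=0\}$, and let $R=D[t;\delta]$ be the differential polynomial ring, with multiplication given by $ty=yt+\delta(y)$ for $y\in D$. Suppose that $\delta$ is algebraic of degree $p$ with minimum polynomial $g(x)=x^p-ax$, $a\in F$; that is, $g$ is the monic polynomial of least degree over $F$ for which $g(\delta)$ is an inner derivation. Let $c\in D$ satisfy $g(\delta)=\delta_c$, where $\delta_c(y)=cy-yc$, and $\delta(c)=0$ (so that $R$ has center $F[g(t)-c]$). Let $f\in R$ be monic of degree $m\ge 1$, and let $h(t)=\hat h(g(t)-c)$, with $\hat h\in F[x]$ monic, be its minimal central left multiple, i.e. the nonzero element of least degree in the center of $R$ that lies in $Rf$. Suppose that $\hat h$ is irreducible in $F[x]$. Call $f$ a generalised A-polynomial if its eigenring $\mathcal E(f)=\{q\in R: fq\in Rf\}/Rf$ is a (finite-dimensional) central simple algebra over $F$. For $\alpha\in D$ let $V_p(\alpha)\in D$ be given by $(t-\alpha)^p=t^p-V_p(\alpha)$, and for $v\in D^\times$ put $\Omega_v(\alpha)=v\alpha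 v^{-1}+\delta(v)v^{-1}$. Then $f$ is a generalised A-polynomial if and only if one of the following holds: (i) $f(t)=h(t)=t^p-at-(b+c)$ for some $b\in F$ such that $V_p(\alpha)-a\alpha-(b+c)\neq 0$ for all $\alpha\in D$; (ii) $h(t)=t^p-at-(b+c)$ for some $b\in F$, $m\le p$, and $f(t)=\prod_{i=1}^m\bigl(t-\Omega_{c_i}(\alpha)\bigr)$ (factors in the order $i=1,\dots,m$ from left to right) for some $\alpha\in D$ and $c_1,\dots,c_m\in D^\times$ with $c_m=1$ such that $V_p(\alpha)-a\alpha-(b+c)=0$. In case (i), $f$ is irreducible in $R$. -/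

import Mathlib

open Polynomial

/-- A derivation of a (not necessarily commutative) ring `D`: an additive map with
`δ (x y) = x δ(y) + δ(x) y`. -/
structure RingDer (D : Type*) [Ring D] extends D →+ D where
  leibniz' : ∀ x y : D, toFun (x * y) = x * toFun y + toFun x * y

namespace RingDer

instance {D : Type*} [Ring D] : FunLike (RingDer D) D D where
  coe δ := δ.toFun
  coe_injective := by
    rintro ⟨f, hf⟩ ⟨g, hg⟩ h
    have : f = g := DFunLike.coe_injective h
    subst this
    rfl

instance {D : Type*} [Ring D] : AddMonoidHomClass (RingDer D) D D where
  map_add δ := δ.map_add'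
  map_zero δ := δ.map_zero'

theorem leibniz {D : Type*} [Ring D] (δ : RingDer D) (x y : D) :
    δ (x * y) = x * δ y + δ x * y := δ.leibniz' x y

theorem map_one_eq_zero {D : Type*} [Ring D] (δ : RingDer D) : δ 1 = 0 := by
  have h := δ.leibniz 1 1
  simp only [mul_one, one_mul] at h
  exact left_eq_add.mp h

/-- The field `F = C ∩ Const(δ)`: the central elements of `D` that are killed by `δ`. -/
def centralConstants {D : Type*} [DivisionRing D] (δ : RingDer D) : Subfield D where
  carrier := {x | x ∈ Subring.center D ∧ δ x = 0}
  mul_mem' := by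
    rintro x y ⟨hx, hx'⟩ ⟨hy, hy'⟩
    exact ⟨mul_mem hx hy, by rw [leibniz, hx', hy']; simp⟩
  one_mem' := ⟨one_mem _, δ.map_one_eq_zero⟩
  add_mem' := by
    rintro x y ⟨hx, hx'⟩ ⟨hy, hy'⟩
    exact ⟨add_mem hx hy, by rw [map_add, hx', hy', add_zero]⟩
  zero_mem' := ⟨zero_mem _, map_zero δ⟩
  neg_mem' := by
    rintro x ⟨hx, hx'⟩
    exact ⟨neg_mem hx, by rw [map_neg, hx', neg_zero]⟩
  inv_mem' := by
    rintro x ⟨hx, hx'⟩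
    refine ⟨Set.inv_mem_center hx, ?_⟩
    by_cases h0 : x = 0
    · subst h0
      simp only [inv_zero]
      exact map_zero δ
    · have h := δ.leibniz x x⁻¹
      have hx2 : δ x = 0 := hx'
      rw [mul_inv_cancel₀ h0, δ.map_one_eq_zero, hx2, zero_mul, add_zero] at h
      exact (mul_eq_zero.mp h.symm).resolve_left h0

theorem commute_of_mem_centralConstants {D : Type*} [DivisionRing D] (δ : RingDer D)
    (a : δ.centralConstants) (x : D) : (a : D) * x = x * a :=
  ((Subring.mem_center_iff.mp a.2.1) x).symm

instance {D : Type*} [DivisionRing D] (δ : RingDer D) : Field δ.centralConstants :=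
  { (inferInstance : DivisionRing δ.centralConstants) with
    mul_comm := fun a b => Subtype.ext (δ.commute_of_mem_centralConstants a b) }

/-- The map `P(δ) : D → D` for a polynomial `P = ∑ rᵢ xⁱ` over `F`, i.e. `x ↦ ∑ rᵢ δⁱ(x)`. -/
noncomputable def polyApply {D : Type*} [DivisionRing D] (δ : RingDer D)
    (P : (δ.centralConstants)[X]) (x : D) : D :=
  P.sum fun i r => (r : D) * (δ^[i] x)

/-- `u : D → D` is the inner derivation `δ_c`, `x ↦ [c, x] = c x - x c`. -/
def IsInnerBy {D : Type*} [Ring D] (u : D → D) (c : D) : Prop :=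
  ∀ x, u x = c * x - x * c

/-- `g` is the minimum polynomial of `δ` over `F`, modulo inner derivations: the monic polynomial
of least degree over `F` for which `g(δ)` is an inner derivation. -/
structure IsMinimumPolynomial {D : Type*} [DivisionRing D] (δ : RingDer D)
    (g : (δ.centralConstants)[X]) : Prop where
  monic : g.Monic
  inner : ∃ c, IsInnerBy (δ.polyApply g) c
  minimal : ∀ P : (δ.centralConstants)[X], P ≠ 0 →
    (∃ e, IsInnerBy (δ.polyApply P) e) → g.degree ≤ P.degree

end RingDer

section Eigenring

variable (k : Type*) {R : Type*} [CommRing k] [Ring R] [Algebra k R]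

/-- The left idealiser `I(f) = {g : f g ∈ R f}` of an element `f` of a `k`-algebra `R`. -/
def leftIdealiser (f : R) : Subalgebra k R where
  carrier := {g | f * g ∈ Ideal.span {f}}
  mul_mem' := by
    intro g g' hg hg'
    obtain ⟨r, hr⟩ := Ideal.mem_span_singleton'.mp hg
    show f * (g * g') ∈ Ideal.span {f}
    rw [← mul_assoc, ← hr, mul_assoc]
    exact Ideal.mul_mem_left _ _ hg'
  add_mem' := by
    intro g g' hg hg'
    show f * (g + g') ∈ Ideal.span {f}
    rw [mul_add]
    exact add_mem hg hg'
  algebraMap_mem' := by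
    intro a
    show f * algebraMap k R a ∈ Ideal.span {f}
    rw [← Algebra.commutes]
    exact Ideal.mul_mem_left _ _ (Ideal.mem_span_singleton_self f)

/-- `R f`, as a left ideal of the left idealiser of `f`. -/
def eigenIdeal (f : R) : Ideal (leftIdealiser k f) :=
  (Ideal.span {f}).comap (leftIdealiser k f).val

/-- `R f` is two-sided in the left idealiser of `f`. -/
instance (f : R) : (eigenIdeal k f).IsTwoSided where
  mul_mem_of_left := by
    intro x y hx
    obtain ⟨r, hr⟩ := Ideal.mem_span_singleton'.mp (show (x : R) ∈ Ideal.span {f} from hx)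
    show (x : R) * (y : R) ∈ Ideal.span {f}
    rw [← hr, mul_assoc]
    exact Ideal.mul_mem_left _ _ y.2

/-- The eigenring `E(f) = I(f) / R f`, a `k`-algebra. -/
abbrev Eigenring (f : R) : Type _ := leftIdealiser k f ⧸ eigenIdeal k f

end Eigenring

/-- The differential polynomial ring `D[t; δ]`. As an additive group it consists of the
polynomials `∑ aᵢ tⁱ` with coefficients written on the left; the multiplication,
with `t a = a t + δ(a)`, is defined below. -/
structure DiffPoly {D : Type*} [Ring D] (δ : RingDer D) where
  /-- The element with given left coefficients. -/
  ofPoly ::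
  /-- The left coefficients. -/
  coeffs : D[X]

namespace DiffPoly

section Basic

variable {D : Type*} [Ring D] {δ : RingDer D}

variable (δ) in
/-- Passing to the polynomial of left coefficients. -/
def coeffsEquiv : DiffPoly δ ≃ D[X] where
  toFun := coeffs
  invFun := ofPoly
  left_inv _ := rfl
  right_inv _ := rfl

noncomputable instance : AddCommGroup (DiffPoly δ) := (coeffsEquiv δ).addCommGroup

/-- `coeffs` as an additive isomorphism. -/
noncomputable def toPoly : DiffPoly δ ≃+ D[X] := (coeffsEquiv δ).addEquiv

/-- The coefficient of `tⁱ`. -/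
noncomputable def coeff (f : DiffPoly δ) (i : ℕ) : D := (toPoly f).coeff i

/-- The degree, with value `0` at `0`. -/
noncomputable def natDegree (f : DiffPoly δ) : ℕ := (toPoly f).natDegree

/-- The degree, with value `⊥` at `0`. -/
noncomputable def degree (f : DiffPoly δ) : WithBot ℕ := (toPoly f).degree

/-- The leading coefficient is `1`. -/
def Monic (f : DiffPoly δ) : Prop := (toPoly f).Monic

variable (δ) in
/-- Left multiplication by `t`: `∑ bⱼ tʲ ↦ ∑ (bⱼ tʲ⁺¹ + δ(bⱼ) tʲ)`. -/
noncomputable def tMul : AddMonoid.End D[X] where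
  toFun g := g * X + g.sum fun j b => monomial j (δ b)
  map_zero' := by simp
  map_add' g g' := by
    rw [add_mul, Polynomial.sum_add_index _ _ _ (by simp) (by simp)]
    abel

/-- Left multiplication by the constant `a`: `∑ bⱼ tʲ ↦ ∑ a bⱼ tʲ`. -/
noncomputable def cMul (a : D) : AddMonoid.End D[X] := AddMonoidHom.mulLeft (Polynomial.C a)

theorem cMul_apply (a : D) (f : D[X]) : cMul a f = Polynomial.C a * f := rfl

theorem cMul_zero : cMul (0 : D) = 0 := by
  refine DFunLike.ext _ _ fun f => ?_
  rw [cMul_apply, map_zero, zero_mul]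
  rfl

theorem cMul_one : cMul (1 : D) = 1 := by
  refine DFunLike.ext _ _ fun f => ?_
  rw [cMul_apply, map_one, one_mul]
  rfl

theorem cMul_add (a b : D) : cMul (a + b) = cMul a + cMul b := by
  refine DFunLike.ext _ _ fun f => ?_
  rw [cMul_apply, map_add, add_mul]
  rfl

theorem cMul_mul (a b : D) : cMul (a * b) = cMul a * cMul b := by
  refine DFunLike.ext _ _ fun f => ?_
  rw [cMul_apply, map_mul, mul_assoc]
  rfl

variable (δ) in
/-- Left multiplication by `∑ aᵢ tⁱ`. -/
noncomputable def leftMul : D[X] →+ AddMonoid.End D[X] where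
  toFun f := f.sum fun i a => cMul a * tMul δ ^ i
  map_zero' := by simp
  map_add' f f' := by
    apply Polynomial.sum_add_index
    · intro i
      rw [cMul_zero, zero_mul]
    · intro i a b
      rw [cMul_add, add_mul]

noncomputable instance : Mul (DiffPoly δ) where
  mul f g := toPoly.symm (leftMul δ (toPoly f) (toPoly g))

noncomputable instance : One (DiffPoly δ) where
  one := toPoly.symm 1

theorem tMul_monomial (j : ℕ) (b : D) :
    tMul δ (monomial j b) = monomial (j + 1) b + monomial j (δ b) := by
  show monomial j b * X + (monomial j b).sum (fun j b => monomial j (δ b)) = _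
  rw [monomial_mul_X, Polynomial.sum_monomial_index _ _ (by simp)]

theorem cMul_monomial (a : D) (j : ℕ) (b : D) : cMul a (monomial j b) = monomial j (a * b) := by
  rw [cMul_apply, C_mul_monomial]

theorem leftMul_monomial (i : ℕ) (a : D) : leftMul δ (monomial i a) = cMul a * tMul δ ^ i := by
  show (monomial i a).sum (fun i a => cMul a * tMul δ ^ i) = _
  rw [Polynomial.sum_monomial_index _ _ (by rw [cMul_zero, zero_mul])]

theorem tMul_mul_cMul (a : D) : tMul δ * cMul a = cMul a * tMul δ + cMul (δ a) := by
  apply Polynomial.addHom_ext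
  intro j b
  show tMul δ (cMul a (monomial j b)) = cMul a (tMul δ (monomial j b)) + cMul (δ a) (monomial j b)
  rw [cMul_monomial, tMul_monomial, tMul_monomial, map_add, cMul_monomial, cMul_monomial,
    cMul_monomial, δ.leibniz, map_add, add_assoc]

theorem leftMul_tMul (g : D[X]) : leftMul δ (tMul δ g) = tMul δ * leftMul δ g := by
  induction g using Polynomial.induction_on' with
  | add p q hp hq => rw [map_add, map_add, map_add, hp, hq, mul_add]
  | monomial j b =>
    rw [tMul_monomial, map_add, leftMul_monomial, leftMul_monomial, leftMul_monomial, ← mul_assoc,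
      tMul_mul_cMul, add_mul, mul_assoc (cMul b), ← pow_succ']

theorem leftMul_cMul (a : D) (g : D[X]) : leftMul δ (cMul a g) = cMul a * leftMul δ g := by
  induction g using Polynomial.induction_on' with
  | add p q hp hq => rw [map_add, map_add, map_add, hp, hq, mul_add]
  | monomial j b =>
    rw [cMul_monomial, leftMul_monomial, leftMul_monomial, ← mul_assoc, cMul_mul]

theorem leftMul_add (f f' g : D[X]) :
    leftMul δ (f + f') g = leftMul δ f g + leftMul δ f' g := by
  rw [map_add]
  rfl

theorem leftMul_mul (f g : D[X]) :
    leftMul δ (leftMul δ f g) = leftMul δ f * leftMul δ g := by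
  induction f using Polynomial.induction_on' with
  | add p q hp hq =>
    rw [leftMul_add, map_add, hp, hq, map_add, add_mul]
  | monomial i a =>
    rw [leftMul_monomial]
    show leftMul δ (cMul a ((tMul δ ^ i) g)) = _
    rw [leftMul_cMul, mul_assoc]
    congr 1
    induction i with
    | zero => simp
    | succ i ih =>
      rw [pow_succ', mul_assoc, ← ih]
      exact leftMul_tMul _

theorem tMul_pow_one (i : ℕ) : (tMul δ ^ i) (1 : D[X]) = monomial i 1 := by
  induction i with
  | zero => simp
  | succ i ih =>
    rw [pow_succ']
    show tMul δ ((tMul δ ^ i) 1) = _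
    rw [ih, tMul_monomial, δ.map_one_eq_zero, map_zero, add_zero]

theorem leftMul_one_right (f : D[X]) : leftMul δ f 1 = f := by
  induction f using Polynomial.induction_on' with
  | add p q hp hq =>
    rw [map_add]
    exact congrArg₂ (· + ·) hp hq
  | monomial i a =>
    rw [leftMul_monomial]
    show cMul a ((tMul δ ^ i) 1) = _
    rw [tMul_pow_one, cMul_monomial, mul_one]

theorem leftMul_one : leftMul δ (1 : D[X]) = 1 := by
  rw [← monomial_zero_one, leftMul_monomial, pow_zero, mul_one, cMul_one]

theorem toPoly_mul (f g : DiffPoly δ) : toPoly (f * g) = leftMul δ (toPoly f) (toPoly g) :=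
  toPoly.apply_symm_apply _

theorem toPoly_one : toPoly (1 : DiffPoly δ) = 1 := toPoly.apply_symm_apply _

noncomputable instance : Ring (DiffPoly δ) :=
  { (inferInstance : AddCommGroup (DiffPoly δ)) with
    mul := (· * ·)
    one := 1
    left_distrib := fun f g h => toPoly.injective <| by
      simp only [toPoly_mul, map_add]
    right_distrib := fun f g h => toPoly.injective <| by
      rw [toPoly_mul, map_add, leftMul_add, map_add, toPoly_mul, toPoly_mul]
    zero_mul := fun f => toPoly.injective <| by
      rw [toPoly_mul, map_zero, map_zero]
      rfl
    mul_zero := fun f => toPoly.injective <| by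
      rw [toPoly_mul, map_zero, map_zero]
    mul_assoc := fun f g h => toPoly.injective <| by
      rw [toPoly_mul, toPoly_mul, toPoly_mul, toPoly_mul, leftMul_mul]
      rfl
    one_mul := fun f => toPoly.injective <| by
      rw [toPoly_mul, toPoly_one, leftMul_one]
      rfl
    mul_one := fun f => toPoly.injective <| by
      rw [toPoly_mul, toPoly_one, leftMul_one_right] }

variable (δ) in
/-- The constants, as a ring homomorphism `D → D[t; δ]`. -/
noncomputable def const : D →+* DiffPoly δ where
  toFun a := ofPoly (Polynomial.C a)
  map_one' := rfl
  map_zero' := toPoly.injective (map_zero Polynomial.C)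
  map_add' a b := toPoly.injective (map_add Polynomial.C a b)
  map_mul' a b := toPoly.injective <| by
    rw [toPoly_mul]
    show monomial 0 (a * b) = leftMul δ (monomial 0 a) (monomial 0 b)
    rw [leftMul_monomial, pow_zero, mul_one, cMul_monomial]

variable (δ) in
/-- The indeterminate `t`. -/
noncomputable def t : DiffPoly δ := ofPoly Polynomial.X

theorem toPoly_const (a : D) : toPoly (const δ a) = monomial 0 a := rfl

theorem toPoly_t : toPoly (t δ) = monomial 1 1 := rfl

/-- The defining relation `t a = a t + δ(a)`. -/
theorem t_mul_const (a : D) : t δ * const δ a = const δ a * t δ + const δ (δ a) := by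
  apply toPoly.injective
  rw [map_add, toPoly_mul, toPoly_mul, toPoly_t, toPoly_const, toPoly_const, leftMul_monomial,
    leftMul_monomial, cMul_one, one_mul, pow_one, pow_zero, mul_one, tMul_monomial, cMul_monomial,
    mul_one]

/-- `a tⁱ` is the polynomial whose only coefficient is `a`, in degree `i`. -/
theorem toPoly_const_mul_t_pow (a : D) (i : ℕ) : toPoly (const δ a * t δ ^ i) = monomial i a := by
  have h : ∀ i : ℕ, toPoly (t δ ^ i) = monomial i 1 := by
    intro i
    induction i with
    | zero => rfl
    | succ i ih =>
      rw [pow_succ', toPoly_mul, ih, toPoly_t, leftMul_monomial, cMul_one, one_mul, pow_one,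
        tMul_monomial, δ.map_one_eq_zero, map_zero, add_zero]
  rw [toPoly_mul, h, toPoly_const, leftMul_monomial, pow_zero, mul_one, cMul_monomial, mul_one]

/-- Every element is `∑ aᵢ tⁱ`. -/
theorem eq_sum (f : DiffPoly δ) :
    f = ∑ i ∈ (toPoly f).support, const δ (coeff f i) * t δ ^ i := by
  apply toPoly.injective
  rw [map_sum]
  simp only [toPoly_const_mul_t_pow]
  exact (toPoly f).as_sum_support

end Basic

section DivisionRing

variable {D : Type*} [DivisionRing D] {δ : RingDer D}

theorem const_mul_comm (a : δ.centralConstants) (f : DiffPoly δ) :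
    const δ a * f = f * const δ a := by
  have hd : δ (a : D) = 0 := a.2.2
  have ht : Commute (const δ (a : D)) (t δ) := by
    show _ = _
    rw [t_mul_const, hd, map_zero, add_zero]
  rw [f.eq_sum]
  refine Commute.sum_right _ _ _ fun i _ => Commute.mul_right ?_ (ht.pow_right i)
  show _ = _
  rw [← map_mul, ← map_mul, δ.commute_of_mem_centralConstants]

/-- `D[t; δ]` is an algebra over `F`, through the constants. -/
noncomputable instance : Algebra δ.centralConstants (DiffPoly δ) :=
  ((const δ).comp δ.centralConstants.subtype).toAlgebra' fun a f => const_mul_comm a f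

/-- `f` is a generalised A-polynomial: its eigenring is a central simple algebra over `F`. -/
structure IsGeneralisedAPolynomial (f : DiffPoly δ) : Prop where
  isSimple : IsSimpleRing (Eigenring δ.centralConstants f)
  isCentral : Algebra.IsCentral δ.centralConstants (Eigenring δ.centralConstants f)
  finite : Module.Finite δ.centralConstants (Eigenring δ.centralConstants f)

/-- Given `z` in `R = D[t; δ]` (the generator of the centre `F[z]` of `R`), `h` is the minimal
central left multiple of `f` in `R`, written as `h = ĥ(z)` with `ĥ ∈ F[x]` monic. -/
structure IsMinimalCentralLeftMultiple (z f h : DiffPoly δ) (hhat : (δ.centralConstants)[X]) :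
    Prop where
  monic : hhat.Monic
  eq_aeval : h = aeval z hhat
  mem_center : h ∈ Subring.center (DiffPoly δ)
  left_multiple : ∃ q, h = q * f
  minimal : ∀ k ∈ Subring.center (DiffPoly δ), k ≠ 0 → (∃ q, k = q * f) → h.degree ≤ k.degree

variable (δ) in
/-- `V_p(b)`, defined through `(t - b)ᵖ = tᵖ - V_p(b)` in `D[t; δ]` for `D` of prime
characteristic `p`, i.e. `V_p(b) = bᵖ + δᵖ⁻¹(b) + ∇_b` with `∇_b` a sum of commutators: the
constant `tᵖ - (t - b)ᵖ`. -/
noncomputable def V (p : ℕ) (b : D) : D := coeff (t δ ^ p - (t δ - const δ b) ^ p) 0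

variable (δ) in
/-- `Ω_v(α) = v α v⁻¹ + δ(v) v⁻¹`. -/
def Omega (v α : D) : D := v * α * v⁻¹ + δ v * v⁻¹

end DivisionRing

end DiffPoly

/-! The key fact is that every central element of `R` of degree less than `p` lies in `F`. Comparing
the two top coefficients of `y q = q y` for a nonconstant central `q` of smaller degree would make a
nonzero `F`-multiple of `δ` inner, against the minimality of `g` (`exists_eq_const_of_mem_center`).
So if `h = t^p - at - (b+c)`, then `R h` is a maximal two-sided ideal and `A = R/Rh` is central
simple over `F`. It is finite-dimensional because `δ^p = aδ` on `C`, and a Wronskian argument then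
gives `[C : F] ≤ p` (`finite_centralConstants`). For a nonconstant right divisor `f` of `h`, write
the left ideal of `A` generated by `f` as `A(1 - e)` with `e` idempotent. The eigenring of `f` is
the corner `eAe`, which is again central simple. Hence the shape of `h` alone already makes `f` a
generalised A-polynomial.

Conversely, if the eigenring is central, the central element `z = g(t) - c` acts on it as a scalar
`b`, so `z - b` lies in `Rf`. Irreducibility then forces `ĥ = x - b` (`eq_X_sub_C_of_aeval_mem`).

It remains to describe the right divisors of such an `h`. Behind this is the fact that a simple ring
acts faithfully on each of its nonzero modules, so any two right divisors of `h` interact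
(`exists_right_factor`). If `h` has a linear right factor `t - α`, linear factors `t - Ω_v(α)` can
be peeled off every divisor, which is case (ii). Otherwise the least degree of a nonconstant divisor
divides the prime `p` and is not `1`; so it is `p` and `f = h`, which is case (i). The remainder of
`h` on right division by `t - α` is `V_p(α) - aα - (b+c)`, so the vanishing condition separates the
two cases. -/

/-- Left multiplication by `x` and right multiplication by `y` commute as additive endomorphisms, so
the Frobenius identity applies to their difference although `x` and `y` need not commute. -/
theorem pow_char_mul_sub_mul_pow_char {S : Type*} [Ring S] (p : ℕ) [Fact p.Prime] [CharP S p]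
    (x y w : S) : x ^ p * w - w * y ^ p = (fun v => x * v - v * y)^[p] w := by
  obtain ⟨l, hl⟩ : ∃ l : AddMonoid.End S, ∀ v, l v = x * v :=
    ⟨AddMonoidHom.mulLeft x, fun _ => rfl⟩
  obtain ⟨r, hr⟩ : ∃ r : AddMonoid.End S, ∀ v, r v = v * y :=
    ⟨AddMonoidHom.mulRight y, fun _ => rfl⟩
  have hsub : ∀ v, (l - r) v = x * v - v * y := fun v => by
    rw [← hl, ← hr]
    rfl
  have hcomm : Commute (l - r) r := by
    refine DFunLike.ext _ _ fun v => ?_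
    show (l - r) (r v) = r ((l - r) v)
    rw [hsub, hsub, hr, hr, sub_mul, mul_assoc x v y]
  -- The `p`-th power is additive up to a multiple of `p`, and that multiple acts as zero on `S`.
  obtain ⟨s, hs⟩ := hcomm.exists_add_pow_prime_eq (Fact.out : p.Prime)
  rw [sub_add_cancel] at hs
  have hlp : ∀ n : ℕ, (l ^ n) w = x ^ n * w := by
    intro n
    induction n with
    | zero => simp
    | succ n ih =>
      rw [pow_succ', pow_succ', mul_assoc, ← ih]
      exact hl _
  have hrp : ∀ n : ℕ, (r ^ n) w = w * y ^ n := by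
    intro n
    induction n with
    | zero => simp
    | succ n ih =>
      rw [pow_succ', pow_succ, ← mul_assoc, ← ih]
      exact hr _
  have hp0 : ∀ v, (p : AddMonoid.End S) v = 0 := fun v => by
    rw [AddMonoid.End.natCast_apply, nsmul_eq_mul, CharP.cast_eq_zero, zero_mul]
  have h : (l ^ p) w = ((l - r) ^ p) w + (r ^ p) w := by
    rw [hs, mul_assoc, mul_assoc]
    show _ + _ + (p : AddMonoid.End S) _ = _
    rw [hp0, add_zero]
    rfl
  have hfun : (⇑(l - r) : S → S) = fun v => x * v - v * y := funext hsub
  rw [hlp, hrp] at h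
  rw [h, add_sub_cancel_right, AddMonoid.End.coe_pow, hfun]

/-! ### Coefficients, division and left ideals in `D[t; δ]`. -/

namespace DiffPoly

section Ring

variable {D : Type*} [Ring D] {δ : RingDer D}

theorem coeff_tMul_zero (g : D[X]) : (tMul δ g).coeff 0 = δ (g.coeff 0) := by
  induction g using Polynomial.induction_on' with
  | add f g hf hg => simp only [map_add, coeff_add, hf, hg]
  | monomial j b =>
    rw [tMul_monomial, coeff_add, coeff_monomial, coeff_monomial, coeff_monomial,
      if_neg (Nat.succ_ne_zero j), zero_add]
    split_ifs <;> simp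

theorem coeff_tMul_succ (g : D[X]) (n : ℕ) :
    (tMul δ g).coeff (n + 1) = g.coeff n + δ (g.coeff (n + 1)) := by
  induction g using Polynomial.induction_on' with
  | add f g hf hg => simp only [map_add, coeff_add, hf, hg]; abel
  | monomial j b =>
    simp only [tMul_monomial, coeff_add, coeff_monomial, add_left_inj]
    congr 1
    split_ifs <;> simp

theorem coeff_tMul_pow_of_lt (g : D[X]) {N : ℕ} (hg : g.natDegree ≤ N) (i n : ℕ)
    (hn : i + N < n) : ((tMul δ ^ i) g).coeff n = 0 := by
  induction i generalizing n with
  | zero => exact coeff_eq_zero_of_natDegree_lt (p := g) (by omega)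
  | succ i ih =>
    obtain ⟨n, rfl⟩ : ∃ k, n = k + 1 := ⟨n - 1, by omega⟩
    rw [pow_succ']
    show (tMul δ ((tMul δ ^ i) g)).coeff (n + 1) = 0
    rw [coeff_tMul_succ, ih _ (by omega), ih _ (by omega), map_zero, add_zero]

theorem coeff_tMul_pow_add (g : D[X]) {N : ℕ} (hg : g.natDegree ≤ N) (i : ℕ) :
    ((tMul δ ^ i) g).coeff (i + N) = g.coeff N := by
  induction i with
  | zero => simp
  | succ i ih =>
    rw [pow_succ', add_right_comm]
    show (tMul δ ((tMul δ ^ i) g)).coeff (i + N + 1) = _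
    rw [coeff_tMul_succ, ih, coeff_tMul_pow_of_lt g hg _ _ (by omega), map_zero, add_zero]

/-- Moving `y` past each of the `i + 1` factors `t` contributes one `δ y` just below the top. This
integer multiple of `δ` is what later contradicts minimality. -/
theorem coeff_tMul_pow_C (y : D) (i : ℕ) :
    ((tMul δ ^ (i + 1)) (Polynomial.C y)).coeff i = (i + 1 : ℕ) * δ y := by
  induction i with
  | zero =>
    rw [pow_succ', pow_zero, mul_one, coeff_tMul_zero]
    simp
  | succ i ih =>
    rw [pow_succ']
    show (tMul δ ((tMul δ ^ (i + 1)) (Polynomial.C y))).coeff (i + 1) = _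
    have h := coeff_tMul_pow_add (δ := δ) (Polynomial.C y) (natDegree_C y).le (i + 1)
    rw [add_zero, coeff_C_zero] at h
    rw [coeff_tMul_succ, ih, h]
    push_cast
    noncomm_ring

theorem leftMul_eq_sum_range (f g : D[X]) {M : ℕ} (hf : f.natDegree ≤ M) :
    leftMul δ f g = ∑ i ∈ Finset.range (M + 1), Polynomial.C (f.coeff i) * (tMul δ ^ i) g := by
  have h : leftMul δ f = f.sum fun i a => cMul a * tMul δ ^ i := rfl
  rw [h, Polynomial.sum_over_range' _ (fun i => by rw [cMul_zero, zero_mul]) (M + 1) (by omega)]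
  exact AddMonoidHom.finsetSum_apply _ _ _

theorem coeff_mul (f g : DiffPoly δ) {M : ℕ} (hf : f.natDegree ≤ M) (n : ℕ) :
    coeff (f * g) n =
      ∑ i ∈ Finset.range (M + 1), coeff f i * ((tMul δ ^ i) (toPoly g)).coeff n := by
  rw [coeff, toPoly_mul, leftMul_eq_sum_range _ _ hf, finsetSum_coeff]
  simp only [coeff_C_mul]
  rfl

theorem coeff_mul_of_lt (f g : DiffPoly δ) {M N : ℕ} (hf : f.natDegree ≤ M)
    (hg : g.natDegree ≤ N) {n : ℕ} (hn : M + N < n) : coeff (f * g) n = 0 := by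
  rw [coeff_mul f g hf]
  refine Finset.sum_eq_zero fun i hi => ?_
  rw [Finset.mem_range] at hi
  rw [coeff_tMul_pow_of_lt _ hg _ _ (by omega), mul_zero]

theorem coeff_mul_add (f g : DiffPoly δ) {M N : ℕ} (hf : f.natDegree ≤ M)
    (hg : g.natDegree ≤ N) : coeff (f * g) (M + N) = coeff f M * coeff g N := by
  rw [coeff_mul f g hf, Finset.sum_range_succ, coeff_tMul_pow_add _ hg, Finset.sum_eq_zero]
  · rw [zero_add]
    rfl
  · intro i hi
    rw [Finset.mem_range] at hi
    rw [coeff_tMul_pow_of_lt _ hg _ _ (by omega), mul_zero]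

theorem coeff_mul_const (f : DiffPoly δ) {k : ℕ} (hf : f.natDegree ≤ k + 1) (y : D) :
    coeff (f * const δ y) k =
      coeff f k * y + coeff f (k + 1) * ((k + 1 : ℕ) * δ y) := by
  have hC : toPoly (const δ y) = Polynomial.C y := rfl
  rw [coeff_mul f _ hf, Finset.sum_range_succ, Finset.sum_range_succ, Finset.sum_eq_zero, hC,
    coeff_tMul_pow_C, zero_add]
  · have h := coeff_tMul_pow_add (δ := δ) (Polynomial.C y) (natDegree_C y).le k
    rw [add_zero, coeff_C_zero] at h
    rw [h]
  · intro i hi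
    rw [Finset.mem_range] at hi
    rw [hC, coeff_tMul_pow_of_lt _ (natDegree_C y).le _ _ (by omega), mul_zero]

theorem toPoly_mul_t (f : DiffPoly δ) : toPoly (f * t δ) = toPoly f * X := by
  conv_lhs => rw [f.eq_sum]
  rw [Finset.sum_mul, map_sum]
  simp only [mul_assoc, ← pow_succ, toPoly_const_mul_t_pow]
  conv_rhs => rw [(toPoly f).as_sum_support]
  rw [Finset.sum_mul]
  simp only [monomial_mul_X]
  rfl

theorem toPoly_t_mul (f : DiffPoly δ) : toPoly (t δ * f) = tMul δ (toPoly f) := by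
  rw [toPoly_mul, toPoly_t, leftMul_monomial, cMul_one, one_mul, pow_one]

theorem toPoly_const_mul (a : D) (f : DiffPoly δ) :
    toPoly (const δ a * f) = Polynomial.C a * toPoly f := by
  rw [toPoly_mul, toPoly_const, leftMul_monomial, pow_zero, mul_one, cMul_apply]

theorem coeff_const_mul (a : D) (f : DiffPoly δ) (n : ℕ) :
    coeff (const δ a * f) n = a * coeff f n := by
  rw [coeff, toPoly_const_mul, coeff_C_mul]
  rfl

theorem coeff_sub' (f g : DiffPoly δ) (n : ℕ) : coeff (f - g) n = coeff f n - coeff g n := by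
  simp only [coeff, map_sub, Polynomial.coeff_sub]

theorem degree_lt_iff {f : DiffPoly δ} {n : ℕ} :
    degree f < n ↔ ∀ m, n ≤ m → coeff f m = 0 := degree_lt_iff_coeff_zero _ _

theorem natDegree_le_iff {f : DiffPoly δ} {n : ℕ} :
    natDegree f ≤ n ↔ ∀ m, n < m → coeff f m = 0 := natDegree_le_iff_coeff_eq_zero

theorem degree_eq_bot' {f : DiffPoly δ} : degree f = ⊥ ↔ f = 0 := by
  rw [degree, Polynomial.degree_eq_bot, map_eq_zero_iff _ toPoly.injective]

theorem degree_eq_natDegree' {f : DiffPoly δ} (hf : f ≠ 0) : degree f = natDegree f :=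
  Polynomial.degree_eq_natDegree ((map_ne_zero_iff _ toPoly.injective).mpr hf)

theorem coeff_natDegree_ne_zero {f : DiffPoly δ} (hf : f ≠ 0) : coeff f (natDegree f) ≠ 0 :=
  leadingCoeff_ne_zero.mpr ((map_ne_zero_iff _ toPoly.injective).mpr hf)

theorem degree_const_le (a : D) : degree (const δ a) ≤ 0 := degree_C_le

theorem eq_const_of_natDegree {f : DiffPoly δ} (hf : f.natDegree = 0) :
    f = const δ (coeff f 0) := toPoly.injective (eq_C_of_natDegree_eq_zero hf)

theorem degree_sub_lt_of_lt {f g : DiffPoly δ} {n : WithBot ℕ} (hf : degree f < n)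
    (hg : degree g < n) : degree (f - g) < n := by
  unfold degree
  rw [map_sub]
  exact (degree_sub_le _ _).trans_lt (max_lt hf hg)

theorem degree_add_le_of_le' {f g : DiffPoly δ} {n : WithBot ℕ} (hf : degree f ≤ n)
    (hg : degree g ≤ n) : degree (f + g) ≤ n := by
  unfold degree
  rw [map_add]
  exact (degree_add_le _ _).trans (max_le hf hg)

theorem const_injective : Function.Injective (const δ) := fun _ _ h =>
  Polynomial.C_injective (congrArg toPoly h)

theorem charP_of_charP (p : ℕ) [CharP D p] : CharP (DiffPoly δ) p :=
  charP_of_injective_ringHom const_injective p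

instance [Nontrivial D] : Nontrivial (DiffPoly δ) := const_injective.nontrivial

theorem Monic.ne_zero' [Nontrivial D] {f : DiffPoly δ} (hf : f.Monic) : f ≠ 0 := by
  rintro rfl
  exact Polynomial.Monic.ne_zero hf (map_zero _)

end Ring

section DivisionRing

variable {D : Type*} [DivisionRing D] {δ : RingDer D}

theorem natDegree_mul' {f g : DiffPoly δ} (hf : f ≠ 0) (hg : g ≠ 0) :
    f * g ≠ 0 ∧ natDegree (f * g) = natDegree f + natDegree g := by
  have h : coeff (f * g) (natDegree f + natDegree g) ≠ 0 := by
    rw [coeff_mul_add f g le_rfl le_rfl]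
    exact mul_ne_zero (coeff_natDegree_ne_zero hf) (coeff_natDegree_ne_zero hg)
  refine ⟨fun h0 => h (by rw [h0, coeff, map_zero, Polynomial.coeff_zero]), le_antisymm ?_ ?_⟩
  · exact natDegree_le_iff.mpr fun m hm => coeff_mul_of_lt f g le_rfl le_rfl hm
  · exact le_natDegree_of_ne_zero h

instance : NoZeroDivisors (DiffPoly δ) where
  eq_zero_or_eq_zero_of_mul_eq_zero {f g} h := by
    by_contra! hfg
    exact (natDegree_mul' hfg.1 hfg.2).1 h

instance : IsDomain (DiffPoly δ) := NoZeroDivisors.to_isDomain _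

theorem degree_mul' (f g : DiffPoly δ) : degree (f * g) = degree f + degree g := by
  by_cases hf : f = 0
  · rw [hf, zero_mul, degree_eq_bot'.mpr rfl, WithBot.bot_add]
  by_cases hg : g = 0
  · rw [hg, mul_zero, degree_eq_bot'.mpr rfl, WithBot.add_bot]
  obtain ⟨h0, h⟩ := natDegree_mul' hf hg
  rw [degree_eq_natDegree' h0, h, degree_eq_natDegree' hf, degree_eq_natDegree' hg]
  rfl

theorem Monic.of_mul_right {f g : DiffPoly δ} (hg : g.Monic) (hfg : (f * g).Monic) :
    f.Monic := by
  have hf0 : f ≠ 0 := by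
    rintro rfl
    exact hfg.ne_zero' (zero_mul _)
  have h := coeff_mul_add f g le_rfl le_rfl
  rw [← (natDegree_mul' hf0 hg.ne_zero').2] at h
  have h1 : coeff (f * g) (natDegree (f * g)) = 1 := hfg
  have h2 : coeff g (natDegree g) = 1 := hg
  rw [h1, h2, mul_one] at h
  exact h.symm

theorem exists_eq_mul_add {h : DiffPoly δ} (hh : h ≠ 0) (f : DiffPoly δ) :
    ∃ q r, f = q * h + r ∧ degree r < degree h := by
  suffices H : ∀ (n : ℕ) (f : DiffPoly δ), degree f < n →
      ∃ q r, f = q * h + r ∧ degree r < degree h by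
    refine H (natDegree f + 1) f ?_
    rw [degree_lt_iff]
    intro m hm
    exact coeff_eq_zero_of_natDegree_lt hm
  intro n
  induction n with
  | zero =>
    intro f hf
    refine ⟨0, 0, ?_, ?_⟩
    · have : f = 0 := by
        rw [degree_lt_iff] at hf
        exact toPoly.injective (Polynomial.ext fun m => by
          rw [map_zero, Polynomial.coeff_zero]; exact hf m (Nat.zero_le m))
      rw [this, zero_mul, add_zero]
    · rw [degree_eq_bot'.mpr rfl, bot_lt_iff_ne_bot, Ne, degree_eq_bot']
      exact hh
  | succ n ih =>
    intro f hf
    by_cases hn : n < natDegree h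
    · refine ⟨0, f, by rw [zero_mul, zero_add], hf.trans_le ?_⟩
      rw [degree_eq_natDegree' hh]
      exact_mod_cast hn
    · set d := natDegree h
      have hd := coeff_natDegree_ne_zero hh
      -- The monomial `s` is chosen so that `s * h` has the same coefficient of `t^n` as `f`.
      set s : DiffPoly δ := const δ (coeff f n * (coeff h d)⁻¹) * t δ ^ (n - d) with hs
      have hsd : natDegree s ≤ n - d := by
        rw [natDegree, hs, toPoly_const_mul_t_pow]
        exact natDegree_monomial_le _
      have hsc : coeff s (n - d) = coeff f n * (coeff h d)⁻¹ := by
        rw [coeff, hs, toPoly_const_mul_t_pow, coeff_monomial, if_pos rfl]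
      have hnd : n - d + d = n := by omega
      have hlt : degree (f - s * h) < n := by
        rw [degree_lt_iff] at hf ⊢
        intro m hm
        rw [coeff_sub']
        rcases hm.eq_or_lt with rfl | hm
        · have := coeff_mul_add s h hsd le_rfl
          rw [hnd, hsc, inv_mul_cancel_right₀ hd] at this
          rw [this, sub_self]
        · rw [hf m hm, coeff_mul_of_lt s h hsd le_rfl (by omega), sub_zero]
      obtain ⟨q, r, hqr, hr⟩ := ih _ hlt
      refine ⟨s + q, r, ?_, hr⟩
      rw [add_mul, add_assoc, ← hqr, add_sub_cancel]

theorem exists_monic_const_mul {f : DiffPoly δ} (hf : f ≠ 0) :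
    ∃ u : D, u ≠ 0 ∧ (const δ u * f).Monic ∧ natDegree (const δ u * f) = natDegree f := by
  have hu := inv_ne_zero (coeff_natDegree_ne_zero hf)
  have hc : const δ (coeff f (natDegree f))⁻¹ ≠ 0 :=
    (map_ne_zero_iff _ const_injective).mpr hu
  have hn : natDegree (const δ (coeff f (natDegree f))⁻¹ * f) = natDegree f := by
    rw [(natDegree_mul' hc hf).2]
    have : natDegree (const δ (coeff f (natDegree f))⁻¹) = 0 := natDegree_C _
    rw [this, zero_add]
  refine ⟨_, hu, ?_, hn⟩
  have : coeff (const δ (coeff f (natDegree f))⁻¹ * f)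
      (natDegree (const δ (coeff f (natDegree f))⁻¹ * f)) = 1 := by
    rw [hn, coeff_const_mul, inv_mul_cancel₀ (coeff_natDegree_ne_zero hf)]
  exact this

/-- A nonzero left ideal is generated by a monic element of least degree in it. -/
theorem exists_monic_span_eq {J : Ideal (DiffPoly δ)} (hJ : J ≠ ⊥) :
    ∃ f : DiffPoly δ, f.Monic ∧ J = Ideal.span {f} ∧
      ∀ u ∈ J, u ≠ 0 → natDegree f ≤ natDegree u := by
  classical
  have hex : ∃ n, ∃ u ∈ J, u ≠ 0 ∧ natDegree u = n := by
    obtain ⟨u, hu, hu0⟩ := Submodule.exists_mem_ne_zero_of_ne_bot hJ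
    exact ⟨_, u, hu, hu0, rfl⟩
  obtain ⟨u, hu, hu0, hun⟩ := Nat.find_spec hex
  obtain ⟨w, hw0, hmon, hdeg⟩ := exists_monic_const_mul hu0
  have hmin : ∀ v ∈ J, v ≠ 0 → natDegree (const δ w * u) ≤ natDegree v := fun v hv hv0 => by
    rw [hdeg, hun]
    exact Nat.find_min' hex ⟨v, hv, hv0, rfl⟩
  have hmem := J.mul_mem_left (const δ w) hu
  refine ⟨_, hmon, le_antisymm (fun v hv => ?_) ?_, hmin⟩
  · obtain ⟨q, r, hqr, hr⟩ := exists_eq_mul_add hmon.ne_zero' v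
    have hrJ : r ∈ J := by
      have : r = v - q * (const δ w * u) := by rw [hqr, add_sub_cancel_left]
      rw [this]
      exact J.sub_mem hv (J.mul_mem_left _ hmem)
    have hr0 : r = 0 := by
      by_contra h0
      have := hmin r hrJ h0
      rw [degree_eq_natDegree' h0, degree_eq_natDegree' hmon.ne_zero'] at hr
      exact absurd (by exact_mod_cast hr) (not_lt.mpr this)
    rw [hqr, hr0, add_zero]
    exact Ideal.mul_mem_left _ _ (Ideal.mem_span_singleton_self _)
  · rw [Ideal.span_le, Set.singleton_subset_iff]
    exact hmem

theorem one_notMem_span {f : DiffPoly δ} (hf : 1 ≤ f.natDegree) :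
    (1 : DiffPoly δ) ∉ Ideal.span {f} := by
  intro h
  obtain ⟨q, hq⟩ := Ideal.mem_span_singleton'.mp h
  have hf0 : f ≠ 0 := by rintro rfl; rw [mul_zero] at hq; exact zero_ne_one hq
  have hq0 : q ≠ 0 := by rintro rfl; rw [zero_mul] at hq; exact zero_ne_one hq
  have := (natDegree_mul' hq0 hf0).2
  rw [hq] at this
  have h1 : natDegree (1 : DiffPoly δ) = 0 := natDegree_C (1 : D)
  omega

theorem isUnit_of_natDegree_eq_zero {f : DiffPoly δ} (hf0 : f ≠ 0) (hf : f.natDegree = 0) :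
    IsUnit f := by
  rw [eq_const_of_natDegree hf]
  refine (IsUnit.mk0 _ fun h0 => hf0 ?_).map (const δ)
  rw [eq_const_of_natDegree hf, h0, map_zero]

/-- Two nonzero elements have a common left multiple of controlled degree. -/
theorem exists_mul_eq_mul (n : ℕ) (f s : DiffPoly δ) (hs : degree s < n) (hf : f ≠ 0) :
    ∃ u w : DiffPoly δ, u ≠ 0 ∧ u * s = w * f ∧ degree u ≤ degree f ∧ degree w ≤ degree s := by
  induction n generalizing f s with
  | zero =>
    have h0 : s = 0 := by
      rw [← degree_eq_bot']
      have h := Nat.WithBot.lt_zero_iff.mp hs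
      exact h
    refine ⟨1, 0, one_ne_zero, by rw [h0, mul_zero, zero_mul], ?_, ?_⟩
    · have : degree (1 : DiffPoly δ) = 0 := degree_C (one_ne_zero (α := D))
      rw [this]
      rw [degree_eq_natDegree' hf]
      exact_mod_cast Nat.zero_le _
    · rw [degree_eq_bot'.mpr rfl]; exact bot_le
  | succ n ih =>
    by_cases hs0 : s = 0
    · subst hs0
      refine ih f 0 ?_ hf
      rw [degree_eq_bot'.mpr rfl]
      exact WithBot.bot_lt_coe n
    -- Euclid's algorithm: from `f = k s + r` and `u' r = w' s` follows `(u' k + w') s = u' f`.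
    obtain ⟨k, r, hkr, hr⟩ := exists_eq_mul_add hs0 f
    have hrn : degree r < n := by
      rw [degree_eq_natDegree' hs0] at hr hs
      refine hr.trans_le ?_
      have : natDegree s < n + 1 := by exact_mod_cast hs
      exact_mod_cast Nat.lt_succ_iff.mp this
    obtain ⟨u', w', hu0, huw, hud, hwd⟩ := ih s r hrn hs0
    -- If `f` had smaller degree than `r`, it would also have smaller degree than `s`; then `k = 0`
    -- and `r = f`.
    have hrf : degree r ≤ degree f := by
      by_contra! hlt
      by_cases hk : k = 0
      · rw [hkr, hk, zero_mul, zero_add] at hlt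
        exact lt_irrefl _ hlt
      · have h1 : degree f < degree s := hlt.trans hr
        have h2 : degree (k * s) < degree s := by
          have : k * s = f - r := by rw [hkr, add_sub_cancel_right]
          rw [this]
          exact degree_sub_lt_of_lt h1 hr
        rw [degree_mul', degree_eq_natDegree' hk, degree_eq_natDegree' hs0] at h2
        have : natDegree k + natDegree s < natDegree s := by exact_mod_cast h2
        omega
    have hks : degree (k * s) ≤ degree f := by
      have : k * s = f + (-r) := by rw [hkr, add_neg_cancel_right]
      rw [this]
      refine degree_add_le_of_le' le_rfl ?_
      unfold degree
      rw [map_neg, degree_neg]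
      exact hrf
    refine ⟨u' * k + w', u', ?_, ?_, ?_, hud⟩
    · intro h0
      have h1 : u' * f = 0 := by
        rw [hkr, mul_add, huw, ← mul_assoc, ← add_mul, h0, zero_mul]
      exact (mul_ne_zero hu0 hf) h1
    · rw [hkr, mul_add, huw, add_mul, mul_assoc]
    · refine degree_add_le_of_le' ?_ (hwd.trans hrf)
      rw [degree_mul']
      refine le_trans (add_le_add hud le_rfl) ?_
      rw [add_comm, ← degree_mul']
      exact hks

end DivisionRing

end DiffPoly

/-! ### Eigenrings as corners of a semisimple quotient. -/

section SimpleQuotient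

/-- In a simple ring every nonzero `x` satisfies `∑ aᵢ x bᵢ = 1` for suitable `aᵢ`, `bᵢ`. -/
theorem IsSimpleRing.exists_sum_mul_mul_eq_one {A : Type*} [Ring A] [IsSimpleRing A] {x : A}
    (hx : x ≠ 0) : ∃ l : List (A × A), (l.map fun q => q.1 * x * q.2).sum = 1 := by
  -- `P` describes the two-sided ideal generated by `x`.
  let P : A → Prop := fun y => ∃ l : List (A × A), (l.map fun q => q.1 * x * q.2).sum = y
  have hl : ∀ {y z}, P z → P (y * z) := by
    rintro y z ⟨l, rfl⟩
    refine ⟨l.map fun q => (y * q.1, q.2), ?_⟩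
    rw [List.map_map, ← List.sum_map_mul_left]
    simp [Function.comp_def, mul_assoc]
  have hr : ∀ {y z}, P y → P (y * z) := by
    rintro y z ⟨l, rfl⟩
    refine ⟨l.map fun q => (q.1, q.2 * z), ?_⟩
    rw [List.map_map, ← List.sum_map_mul_right]
    simp [Function.comp_def, mul_assoc]
  let I : TwoSidedIdeal A := TwoSidedIdeal.mk' {y | P y} ⟨[], rfl⟩
    (by
      rintro y z ⟨l, rfl⟩ ⟨l', rfl⟩
      exact ⟨l ++ l', by simp⟩)
    (by
      intro y hy
      rw [← neg_one_mul]
      exact hl hy)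
    hl hr
  have hmem : ∀ y, y ∈ I ↔ P y := fun y => by
    rw [TwoSidedIdeal.mem_mk']
    rfl
  refine (hmem 1).mp (IsSimpleRing.one_mem_of_ne_zero_mem I hx ((hmem x).mpr ⟨[(1, 1)], ?_⟩))
  simp

variable {k R A : Type*} [Field k] [Ring R] [Algebra k R] [Ring A] [Algebra k A]
  (π : R →ₐ[k] A) (f : R)

theorem mk_eigenring_eq_iff {u v : leftIdealiser k f} :
    (Ideal.Quotient.mk (eigenIdeal k f) u = Ideal.Quotient.mk (eigenIdeal k f) v) ↔
      (u : R) - v ∈ Ideal.span {f} := Ideal.Quotient.eq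

/-- A lift of the idempotent that cuts out a complement of the left ideal generated by the image
of `f` in a semisimple quotient. -/
theorem exists_lift_idempotent
    (hπ : Function.Surjective π)
    [IsSemisimpleRing A] :
    ∃ e : R, π (f * e) = 0 ∧ ∃ r, π (1 - e) = π (r * f) := by
  -- In `A` the left ideal generated by `π f` is `A e₀`; the element `e` lifts the complementary
  -- idempotent `1 - e₀`.
  obtain ⟨e₀, he₀, hspan⟩ := IsSemisimpleRing.ideal_eq_span_idempotent (Ideal.span {π f})
  obtain ⟨e, he⟩ := hπ (1 - e₀)
  have h1 : π f ∈ Ideal.span {e₀} := hspan ▸ Ideal.mem_span_singleton_self _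
  have h2 : e₀ ∈ Ideal.span {π f} := hspan ▸ Ideal.mem_span_singleton_self _
  obtain ⟨x, hx⟩ := Ideal.mem_span_singleton'.mp h1
  obtain ⟨y, hy⟩ := Ideal.mem_span_singleton'.mp h2
  obtain ⟨r, rfl⟩ := hπ y
  refine ⟨e, ?_, r, ?_⟩
  · rw [map_mul, he, ← hx, mul_sub, mul_one, mul_assoc, he₀.eq, sub_self]
  · rw [map_sub, map_one, he, map_mul, hy, sub_sub_cancel]

section Lift

variable {π f} {e : R}

theorem mul_mem_leftIdealiser
    (hker : ∀ x, π x = 0 → x ∈ Ideal.span {f}) (hfe : π (f * e) = 0)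
    (w : R) : e * w ∈ leftIdealiser k f := by
  show f * (e * w) ∈ Ideal.span {f}
  apply hker
  rw [← mul_assoc, map_mul, hfe, zero_mul]

/-- Together with its converse below, this says that `x` lies in `R f` exactly when `π (x * e) = 0`.
Equality in the eigenring can thus be tested inside `A`. -/
theorem map_mul_eq_zero_of_mem_span
    (hfe : π (f * e) = 0)
    {x : R} (hx : x ∈ Ideal.span {f}) : π (x * e) = 0 := by
  obtain ⟨r, rfl⟩ := Ideal.mem_span_singleton'.mp hx
  rw [mul_assoc, map_mul, hfe, mul_zero]

theorem mem_span_of_map_mul_eq_zero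
    (hker : ∀ x, π x = 0 → x ∈ Ideal.span {f}) (he : (1 : R) - e ∈ Ideal.span {f})
    {x : R} (hx : π (x * e) = 0) : x ∈ Ideal.span {f} := by
  have h : x = x * (1 - e) + x * e := by rw [mul_sub, mul_one, sub_add_cancel]
  rw [h]
  exact add_mem (Ideal.mul_mem_left _ _ he) (hker _ hx)

theorem sub_mul_mem_span
    (he : (1 : R) - e ∈ Ideal.span {f})
    {u : R} (hu : f * u ∈ Ideal.span {f}) :
    u - e * u ∈ Ideal.span {f} := by
  obtain ⟨r, hr⟩ := Ideal.mem_span_singleton'.mp he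
  have h : u - e * u = r * (f * u) := by rw [← mul_assoc, hr, sub_mul, one_mul]
  rw [h]
  exact Ideal.mul_mem_left _ _ hu

end Lift

theorem mem_span_of_map_eq_map_of_mem {π : R →ₐ[k] A} {f : R}
    (hker : ∀ x, π x = 0 → x ∈ Ideal.span {f}) {x y : R} (h : π x = π y)
    (hy : y ∈ Ideal.span {f}) : x ∈ Ideal.span {f} := by
  have hxy := hker (x - y) (by rw [map_sub, h, sub_self])
  rw [← sub_add_cancel x y]
  exact add_mem hxy hy

/-- A corner `eAe` of a simple ring is simple: from `∑ aᵢ (ue) bᵢ = 1` in `A` one gets `∑ (e aᵢ) u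
(e bᵢ) ≡ 1` in the eigenring, so an ideal containing a nonzero class `u` is everything. -/
theorem isSimpleRing_eigenring
    (hπ : Function.Surjective π) (hker : ∀ x, π x = 0 → x ∈ Ideal.span {f})
    [IsSimpleRing A] [IsSemisimpleRing A]
    (hf : (1 : R) ∉ Ideal.span {f}) : IsSimpleRing (Eigenring k f) := by
  obtain ⟨e, hfe, r, her⟩ := exists_lift_idempotent π f hπ
  have he : (1 : R) - e ∈ Ideal.span {f} := mem_span_of_map_eq_map_of_mem hker her
    (Ideal.mul_mem_left _ _ (Ideal.mem_span_singleton_self f))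
  have : Nontrivial (Eigenring k f) := Ideal.Quotient.nontrivial_iff.mpr fun h =>
    hf ((Ideal.eq_top_iff_one (eigenIdeal k f)).mp h)
  refine .of_eq_bot_or_eq_top fun I => ?_
  rw [or_iff_not_imp_left]
  intro hI
  obtain ⟨ū, huI, hu0⟩ := SetLike.exists_of_lt (bot_lt_iff_ne_bot.mpr hI)
  obtain ⟨u, rfl⟩ := Ideal.Quotient.mk_surjective ū
  have hu : (u : R) ∉ Ideal.span {f} := fun h =>
    hu0 ((TwoSidedIdeal.mem_bot _).mpr (Ideal.Quotient.eq_zero_iff_mem.mpr h))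
  have hue : π (u * e) ≠ 0 := fun h => hu (mem_span_of_map_mul_eq_zero hker he h)
  obtain ⟨l, hl⟩ := IsSimpleRing.exists_sum_mul_mul_eq_one hue
  choose s hs using hπ
  let E : R → leftIdealiser k f := fun w => ⟨e * w, mul_mem_leftIdealiser hker hfe w⟩
  let y : leftIdealiser k f := (l.map fun q => E (s q.1) * u * E (s q.2)).sum
  have hy : Ideal.Quotient.mk (eigenIdeal k f) y = 1 := by
    rw [← map_one (Ideal.Quotient.mk (eigenIdeal k f)), mk_eigenring_eq_iff]
    refine mem_span_of_map_mul_eq_zero hker he ?_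
    have hyv : (y : R) = e * (l.map fun q => s q.1 * (u * e) * s q.2).sum := by
      show (leftIdealiser k f).val y = _
      rw [map_list_sum, List.map_map, ← List.sum_map_mul_left]
      congr 1
      refine List.map_congr_left fun q _ => ?_
      show e * s q.1 * u * (e * s q.2) = _
      simp only [mul_assoc]
    have hπy : π y = π e := by
      rw [hyv, map_mul, map_list_sum, List.map_map]
      have : (l.map (π ∘ fun q => s q.1 * (u * e) * s q.2)) =
          l.map fun q => q.1 * π (u * e) * q.2 :=
        List.map_congr_left fun q _ => by
          simp only [Function.comp, map_mul, hs]
      rw [this, hl, mul_one]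
    have h1 : π ((1 - e) * e) = 0 := map_mul_eq_zero_of_mem_span hfe he
    -- The element `y` maps to `π e`, and `e` represents `1` in the eigenring since `1 - e` lies in
    -- `R f`.
    rw [map_mul, map_sub, hπy]
    show (π e - π 1) * π e = 0
    rw [← map_sub, ← neg_sub, map_neg, neg_mul, ← map_mul, h1, neg_zero]
  rw [← I.one_mem_iff, ← hy]
  have hyI : ∀ l' : List (A × A), Ideal.Quotient.mk (eigenIdeal k f)
      (l'.map fun q => E (s q.1) * u * E (s q.2)).sum ∈ I := by
    intro l'
    induction l' with
    | nil => simp only [List.map_nil, List.sum_nil, map_zero]; exact I.zero_mem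
    | cons q l' ih =>
      rw [List.map_cons, List.sum_cons, map_add, map_mul, map_mul]
      exact I.add_mem (I.mul_mem_right _ _ (I.mul_mem_left _ _ huI)) ih
  exact hyI l

/-- The centre of a corner `eAe` with `AeA = A` is `e Z(A)`: a central element of the corner extends
to a central element of `A`, hence is a scalar. -/
theorem isCentral_eigenring
    (hπ : Function.Surjective π) (hker : ∀ x, π x = 0 → x ∈ Ideal.span {f})
    [IsSimpleRing A] [IsSemisimpleRing A] [Algebra.IsCentral k A]
    (hf : (1 : R) ∉ Ideal.span {f}) : Algebra.IsCentral k (Eigenring k f) := by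
  obtain ⟨e, hfe, r, her⟩ := exists_lift_idempotent π f hπ
  have he : (1 : R) - e ∈ Ideal.span {f} := mem_span_of_map_eq_map_of_mem hker her
    (Ideal.mul_mem_left _ _ (Ideal.mem_span_singleton_self f))
  have he0 : π e ≠ 0 := fun h =>
    hf (mem_span_of_map_mul_eq_zero hker he (by rw [one_mul, h]))
  refine ⟨fun ū hū => ?_⟩
  obtain ⟨u, rfl⟩ := Ideal.Quotient.mk_surjective ū
  rw [Subalgebra.mem_center_iff] at hū
  set x := π u * π e with hx
  -- Centrality of `u` is tested against the classes of `e * w`, which lie in the idealiser for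
  -- every `w`.
  have hcomm : ∀ w : A, π e * w * x = x * w * π e := by
    intro w
    obtain ⟨w, rfl⟩ := hπ w
    have h := hū (Ideal.Quotient.mk (eigenIdeal k f) ⟨e * w, mul_mem_leftIdealiser hker hfe w⟩)
    rw [← map_mul, ← map_mul, mk_eigenring_eq_iff] at h
    have h2 := map_mul_eq_zero_of_mem_span (π := π) hfe h
    rw [map_mul, map_sub, sub_mul, sub_eq_zero] at h2
    have h3 : π (e * w * u) * π e = π (u * (e * w)) * π e := h2
    simp only [map_mul] at h3
    rw [hx]
    simp only [mul_assoc] at h3 ⊢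
    exact h3
  obtain ⟨l, hl⟩ := IsSimpleRing.exists_sum_mul_mul_eq_one he0
  -- Replacing `π e` by `x` in the expression `∑ aᵢ (π e) bᵢ = 1` gives the central `z` with `z * π
  -- e = x`. By `hcomm`, multiplying by `z` on either side turns `a (π e) b` into `a x b`.
  set z := (l.map fun q => q.1 * x * q.2).sum with hz
  have hleft : ∀ a b, z * (a * π e * b) = a * x * b := by
    intro a b
    calc z * (a * π e * b) = (l.map fun q => q.1 * π e * q.2 * (a * x * b)).sum := by
          rw [hz, ← List.sum_map_mul_right]
          congr 1
          refine List.map_congr_left fun q _ => ?_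
          have h := hcomm (q.2 * a)
          calc q.1 * x * q.2 * (a * π e * b) = q.1 * (x * (q.2 * a) * π e) * b := by
                simp only [mul_assoc]
            _ = q.1 * π e * q.2 * (a * x * b) := by rw [← h]; simp only [mul_assoc]
      _ = a * x * b := by rw [List.sum_map_mul_right, hl, one_mul]
  have hright : ∀ a b, a * π e * b * z = a * x * b := by
    intro a b
    calc a * π e * b * z = (l.map fun q => a * x * b * (q.1 * π e * q.2)).sum := by
          rw [hz, ← List.sum_map_mul_left]
          congr 1
          refine List.map_congr_left fun q _ => ?_
          have h := hcomm (b * q.1)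
          calc a * π e * b * (q.1 * x * q.2) = a * (π e * (b * q.1) * x) * q.2 := by
                simp only [mul_assoc]
            _ = a * x * b * (q.1 * π e * q.2) := by rw [h]; simp only [mul_assoc]
      _ = a * x * b := by rw [List.sum_map_mul_left, hl, mul_one]
  have hzc : z ∈ Subalgebra.center k A := by
    rw [Subalgebra.mem_center_iff]
    intro y
    have h1 : ∀ l' : List (A × A), z * (l'.map fun q => q.1 * π e * q.2).sum * y =
        (l'.map fun q => q.1 * π e * q.2).sum * y * z := by
      intro l'
      induction l' with
      | nil => simp
      | cons q l' ih =>
        rw [List.map_cons, List.sum_cons, mul_add, add_mul, add_mul, add_mul, ih, hleft]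
        congr 1
        rw [mul_assoc _ q.2 y, mul_assoc (q.1 * π e) q.2 y, hright]
    have := h1 l
    rw [hl, mul_one, one_mul] at this
    exact this.symm
  obtain ⟨b, hb⟩ := Algebra.mem_bot.mp (Algebra.IsCentral.out hzc)
  have hze : z * π e = x := by
    have := hleft 1 1
    rwa [one_mul, mul_one, one_mul, mul_one] at this
  rw [Algebra.mem_bot]
  refine ⟨b, ?_⟩
  have hb' : algebraMap k (Eigenring k f) b =
      Ideal.Quotient.mk (eigenIdeal k f) (algebraMap k _ b) := rfl
  rw [hb', mk_eigenring_eq_iff]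
  refine mem_span_of_map_mul_eq_zero hker he ?_
  rw [map_mul, map_sub, sub_mul]
  show π (algebraMap k R b) * π e - π u * π e = 0
  rw [AlgHom.commutes, hb, hze, sub_self]

/-- The map `w ↦ e w` sends `R` onto the eigenring, because `u ≡ e u` for `u` in the idealiser. It
kills the kernel of `π`, so the eigenring is a linear quotient of `A`. -/
theorem finite_eigenring
    (hπ : Function.Surjective π) (hker : ∀ x, π x = 0 → x ∈ Ideal.span {f})
    [IsSemisimpleRing A] [Module.Finite k A] :
    Module.Finite k (Eigenring k f) := by
  obtain ⟨e, hfe, r, her⟩ := exists_lift_idempotent π f hπ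
  have he : (1 : R) - e ∈ Ideal.span {f} := mem_span_of_map_eq_map_of_mem hker her
    (Ideal.mul_mem_left _ _ (Ideal.mem_span_singleton_self f))
  let φ : R →ₗ[k] Eigenring k f :=
    { toFun := fun w =>
        Ideal.Quotient.mk (eigenIdeal k f) ⟨e * w, mul_mem_leftIdealiser hker hfe w⟩
      map_add' := fun v w => by
        rw [← map_add]
        congr 1
        exact Subtype.ext (mul_add e v w)
      map_smul' := fun a w => by
        have : (⟨e * (a • w), mul_mem_leftIdealiser hker hfe _⟩ : leftIdealiser k f) =
            a • ⟨e * w, mul_mem_leftIdealiser hker hfe w⟩ :=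
          Subtype.ext (mul_smul_comm a e w)
        rw [this]
        rfl }
  have hφ : Function.Surjective φ := by
    intro ū
    obtain ⟨u, rfl⟩ := Ideal.Quotient.mk_surjective ū
    refine ⟨u, ?_⟩
    show Ideal.Quotient.mk (eigenIdeal k f) _ = _
    rw [mk_eigenring_eq_iff, ← neg_mem_iff, neg_sub]
    exact sub_mul_mem_span he u.2
  have hle : LinearMap.ker π.toLinearMap ≤ LinearMap.ker φ := by
    intro w hw
    rw [LinearMap.mem_ker] at hw ⊢
    have hw' : π w = 0 := hw
    show Ideal.Quotient.mk (eigenIdeal k f) _ = 0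
    rw [Ideal.Quotient.eq_zero_iff_mem]
    show e * w ∈ Ideal.span {f}
    exact hker _ (by rw [map_mul, hw', mul_zero])
  let ψ := (LinearMap.ker π.toLinearMap).liftQ φ hle
  have hψ : Function.Surjective ψ := fun y => by
    obtain ⟨w, rfl⟩ := hφ y
    exact ⟨Submodule.Quotient.mk w, Submodule.liftQ_apply _ _ _⟩
  have hfin : Module.Finite k (R ⧸ LinearMap.ker π.toLinearMap) :=
    Module.Finite.equiv (π.toLinearMap.quotKerEquivOfSurjective hπ).symm
  exact Module.Finite.of_surjective ψ hψ

end SimpleQuotient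

/-! ### Finiteness of `D` over `F`, by Wronskians. -/

namespace RingDer

variable {D : Type*} [DivisionRing D] (δ : RingDer D)

theorem map_mem_center {x : D} (hx : x ∈ Subring.center D) : δ x ∈ Subring.center D := by
  rw [Subring.mem_center_iff] at hx ⊢
  intro y
  have h := congrArg δ (hx y)
  rw [δ.leibniz, δ.leibniz, ← hx (δ y), add_comm, add_right_inj] at h
  exact h

theorem iterate_mem_center {x : D} (hx : x ∈ Subring.center D) (n : ℕ) :
    δ^[n] x ∈ Subring.center D := by
  induction n with
  | zero => exact hx
  | succ n ih =>
    rw [Function.iterate_succ_apply']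
    exact δ.map_mem_center ih

/-- Central elements that are linearly independent over the constants `F` have linearly
independent Wronskian vectors, for derivations with `δⁿ = a δᵏ` on the centre, `k < n`. -/
theorem linearIndependent_wronskian {n k : ℕ} (hk : k < n) (a : D)
    (hδ : ∀ x ∈ Subring.center D, δ^[n] x = a * δ^[k] x)
    {ι : Type*} (y : ι → D) (hyc : ∀ i, y i ∈ Subring.center D)
    (hy : LinearIndependent δ.centralConstants y) :
    LinearIndependent D fun i => fun j : Fin n => δ^[j] (y i) := by
  classical
  rw [linearIndependent_iff']
  suffices H : ∀ (s : Finset ι) (g : ι → D),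
      (∀ j < n, ∑ i ∈ s, g i * δ^[j] (y i) = 0) → ∀ i ∈ s, g i = 0 by
    intro s g hg
    refine H s g fun j hj => ?_
    have := congrFun hg ⟨j, hj⟩
    simpa using this
  intro s
  induction s using Finset.induction_on with
  | empty => simp
  | insert i₀ s hi₀ ih =>
    intro g hg
    have h0 : g i₀ = 0 := by
      by_contra h0
      -- Normalise the coefficient of `y i₀` to `1`. Differentiating the relation, or commuting it
      -- with an element of `D`, then removes this term and leaves a shorter relation.
      let l : ι → D := fun i => (g i₀)⁻¹ * g i
      have hrel : ∀ j < n, δ^[j] (y i₀) + ∑ i ∈ s, l i * δ^[j] (y i) = 0 := by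
        intro j hj
        have h := congrArg (fun x => (g i₀)⁻¹ * x) (hg j hj)
        simp only [mul_zero, Finset.mul_sum, ← mul_assoc] at h
        rw [Finset.sum_insert hi₀, inv_mul_cancel₀ h0, one_mul] at h
        exact h
      -- Only `j + 1 = n` is new. There the `n`-th derivative is `a` times the `k`-th, and `a` can
      -- be factored out on the right because the derivatives are central.
      have hrel' : ∀ j < n, δ^[j + 1] (y i₀) + ∑ i ∈ s, l i * δ^[j + 1] (y i) = 0 := by
        intro j hj
        rcases Nat.lt_or_ge (j + 1) n with h | h
        · exact hrel _ h
        · have hjn : j + 1 = n := by omega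
          have hac : ∀ i, l i * (a * δ^[k] (y i)) = l i * δ^[k] (y i) * a := fun i => by
            rw [mul_assoc (l i), Subring.mem_center_iff.mp (δ.iterate_mem_center (hyc i) k) a]
          rw [hjn, hδ _ (hyc _)]
          simp only [hδ _ (hyc _), hac]
          rw [Subring.mem_center_iff.mp (δ.iterate_mem_center (hyc i₀) k) a, ← Finset.sum_mul,
            ← add_mul, hrel k hk, zero_mul]
      have hder : ∀ i ∈ s, δ (l i) = 0 := ih (fun i => δ (l i)) fun j hj => by
        have h := congrArg δ (hrel j hj)
        rw [map_zero, map_add, map_sum] at h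
        simp only [δ.leibniz, ← Function.iterate_succ_apply' δ] at h
        rw [Finset.sum_add_distrib, ← add_assoc, hrel' j hj, zero_add] at h
        exact h
      have hcen : ∀ i ∈ s, l i ∈ Subring.center D := fun i hi => by
        rw [Subring.mem_center_iff]
        intro d
        have := ih (fun i => d * l i - l i * d) (fun j hj => by
          have h1 := congrArg (fun x => d * x) (hrel j hj)
          have h2 := congrArg (fun x => x * d) (hrel j hj)
          simp only [mul_zero, zero_mul, mul_add, add_mul, Finset.mul_sum, Finset.sum_mul]
            at h1 h2
          have h3 := h1.trans h2.symm
          rw [Subring.mem_center_iff.mp (δ.iterate_mem_center (hyc i₀) j) d, add_right_inj] at h3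
          simp only [sub_mul, Finset.sum_sub_distrib]
          rw [sub_eq_zero]
          simp only [mul_assoc] at h3 ⊢
          rw [h3]
          refine Finset.sum_congr rfl fun i _ => ?_
          rw [Subring.mem_center_iff.mp (δ.iterate_mem_center (hyc i) j) d]) i hi
        exact sub_eq_zero.mp this
      -- All coefficients now lie in `F`; the default value `1` is the normalised coefficient at
      -- `i₀`.
      let c : ι → δ.centralConstants := fun i =>
        if hi : i ∈ s then ⟨l i, hcen i hi, hder i hi⟩ else 1
      have h1 := linearIndependent_iff'.mp hy (insert i₀ s) c (by
        rw [Finset.sum_insert hi₀]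
        have hc0 : c i₀ = 1 := dif_neg hi₀
        rw [hc0, one_smul, ← hrel 0 (by omega)]
        simp only [Function.iterate_zero, id]
        congr 1
        refine Finset.sum_congr rfl fun i hi => ?_
        have : c i = ⟨l i, hcen i hi, hder i hi⟩ := dif_pos hi
        rw [this]
        rfl) i₀ (Finset.mem_insert_self _ _)
      rw [show c i₀ = 1 from dif_neg hi₀] at h1
      exact one_ne_zero h1
    intro i hi
    rcases Finset.mem_insert.mp hi with rfl | hi
    · exact h0
    · refine ih g (fun j hj => ?_) i hi
      have := hg j hj
      rwa [Finset.sum_insert hi₀, h0, zero_mul, zero_add] at this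

/-- Elements of `C` independent over `F` have `D`-independent Wronskian vectors in `D^n`, so `[C :
F] ≤ n`. Finiteness of `D` over `C` does the rest. -/
theorem finite_centralConstants [Module.Finite (Subring.center D) D] {n k : ℕ} (hk : k < n)
    (a : D) (hδ : ∀ x ∈ Subring.center D, δ^[n] x = a * δ^[k] x) :
    Module.Finite δ.centralConstants D := by
  let ι : δ.centralConstants →+* Subring.center D :=
    { toFun := fun x => ⟨x, x.2.1⟩
      map_one' := rfl
      map_mul' := fun _ _ => rfl
      map_zero' := rfl
      map_add' := fun _ _ => rfl }
  let : Algebra δ.centralConstants (Subring.center D) := ι.toAlgebra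
  have : IsScalarTower δ.centralConstants (Subring.center D) D :=
    ⟨fun x y z => mul_assoc (x : D) y z⟩
  have hrank : Module.rank δ.centralConstants (Subring.center D) ≤ n := by
    refine rank_le fun s hs => ?_
    let v : (Subring.center D) →ₗ[δ.centralConstants] D :=
      { toFun := fun x => x
        map_add' := fun _ _ => rfl
        map_smul' := fun _ _ => rfl }
    have h1 := hs.map' v (LinearMap.ker_eq_bot.mpr Subtype.val_injective)
    have h2 := δ.linearIndependent_wronskian hk a hδ _ (fun i => i.1.2) h1
    have h3 := h2.fintype_card_le_finrank
    simpa using h3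
  have : Module.Finite δ.centralConstants (Subring.center D) :=
    Module.rank_lt_aleph0_iff.mp (hrank.trans_lt (Cardinal.natCast_lt_aleph0))
  exact Module.Finite.trans (Subring.center D) D

end RingDer

/-! ### Nonzero `F`-multiples of `δ` are not inner. -/

namespace RingDer

variable {D : Type*} [DivisionRing D] (δ : RingDer D)

theorem polyApply_C_mul_X (r : δ.centralConstants) (x : D) :
    δ.polyApply (C r * X) x = r * δ x := by
  rw [polyApply, C_mul_X_eq_monomial,
    Polynomial.sum_monomial_index _ (fun i (r : δ.centralConstants) => (r : D) * δ^[i] x)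
      (zero_mul _)]
  rfl

theorem polyApply_X_pow_sub_C_mul_X (p : ℕ) (a : δ.centralConstants) (x : D) :
    δ.polyApply (X ^ p - C a * X) x = δ^[p] x - a * δ x := by
  have h : (X ^ p - C a * X : (δ.centralConstants)[X]) = monomial p 1 + monomial 1 (-a) := by
    rw [X_pow_eq_monomial, C_mul_X_eq_monomial, map_neg, sub_eq_add_neg]
  rw [polyApply, h, Polynomial.sum_add_index _ _
      (fun i (r : δ.centralConstants) => (r : D) * δ^[i] x) (fun i => zero_mul _)
      (fun i r s => add_mul (r : D) s _),
    Polynomial.sum_monomial_index _ (fun i (r : δ.centralConstants) => (r : D) * δ^[i] x)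
      (zero_mul _),
    Polynomial.sum_monomial_index _ (fun i (r : δ.centralConstants) => (r : D) * δ^[i] x)
      (zero_mul _)]
  show (1 : D) * _ + (-(a : D)) * δ x = _
  rw [one_mul, neg_mul, sub_eq_add_neg]

theorem IsMinimumPolynomial.not_inner {δ : RingDer D} {p : ℕ} (hp : 1 < p)
    {a : δ.centralConstants} (hg : δ.IsMinimumPolynomial (X ^ p - C a * X))
    {r : δ.centralConstants} (hr : r ≠ 0) (e : D) : ¬ ∀ x, r * δ x = e * x - x * e := by
  intro h
  have hdeg : (C a * X : (δ.centralConstants)[X]).degree <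
      (X ^ p : (δ.centralConstants)[X]).degree := by
    rw [degree_X_pow]
    exact (degree_C_mul_X_le a).trans_lt (by exact_mod_cast hp)
  have h1 := hg.minimal (C r * X) (by simpa using hr)
    ⟨e, fun x => by rw [polyApply_C_mul_X, h]⟩
  rw [degree_sub_eq_left_of_degree_lt hdeg, degree_X_pow, degree_C_mul_X hr] at h1
  exact absurd (by exact_mod_cast h1) (not_le.mpr hp)

end RingDer

/-! ### Commutators, `p`-th powers and central elements of low degree. -/

namespace DiffPoly

variable {D : Type*} [DivisionRing D] {δ : RingDer D}

theorem mem_center_of_commute {f : DiffPoly δ} (ht : t δ * f = f * t δ)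
    (hc : ∀ y, const δ y * f = f * const δ y) : f ∈ Subring.center (DiffPoly δ) := by
  rw [Subring.mem_center_iff]
  intro g
  rw [g.eq_sum]
  exact Commute.sum_left _ _ _ fun i _ => Commute.mul_left (hc _) (Commute.pow_left ht i)

/-- Since `[t, ·]` is `δ` on coefficients, it does not raise degrees, it lowers the degree of a
monic element, and central elements have coefficients killed by `δ`. -/
theorem coeff_t_mul_sub_mul_t (f : DiffPoly δ) (n : ℕ) :
    coeff (t δ * f - f * t δ) n = δ (coeff f n) := by
  rw [coeff_sub']
  simp only [coeff, toPoly_t_mul, toPoly_mul_t]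
  cases n with
  | zero => rw [coeff_tMul_zero, mul_coeff_zero, coeff_X_zero, mul_zero, sub_zero]
  | succ n => rw [coeff_tMul_succ, coeff_mul_X, add_sub_cancel_left]

theorem coeff_mul_const_of_natDegree_le {f : DiffPoly δ} {n : ℕ} (hf : f.natDegree ≤ n) (y : D) :
    coeff (f * const δ y) n = coeff f n * y := by
  have h := coeff_mul_add f (const δ y) hf (natDegree_C y).le
  rw [add_zero] at h
  exact h.trans (congrArg (coeff f n * ·) coeff_C_zero)

theorem eq_zero_of_mem_span_of_degree_lt {h x : DiffPoly δ} (hx : x ∈ Ideal.span {h})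
    (hd : degree x < degree h) : x = 0 := by
  obtain ⟨q, rfl⟩ := Ideal.mem_span_singleton'.mp hx
  by_contra h0
  have hq : q ≠ 0 := left_ne_zero_of_mul h0
  have hh : h ≠ 0 := right_ne_zero_of_mul h0
  rw [degree_mul', degree_eq_natDegree' hq, degree_eq_natDegree' hh] at hd
  have : natDegree q + natDegree h < natDegree h := by exact_mod_cast hd
  omega

theorem degree_mul_const_lt {f : DiffPoly δ} {n : WithBot ℕ} (hf : degree f < n) (y : D) :
    degree (f * const δ y) < n := by
  rw [degree_mul']
  refine (add_le_add le_rfl (degree_const_le y)).trans_lt ?_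
  rwa [add_zero]

theorem degree_const_mul_lt {f : DiffPoly δ} {n : WithBot ℕ} (hf : degree f < n) (y : D) :
    degree (const δ y * f) < n := by
  rw [degree_mul', add_comm, ← degree_mul']
  exact degree_mul_const_lt hf y

theorem degree_t_mul_sub_mul_t_lt {f : DiffPoly δ} {n : ℕ} (hf : degree f < n) :
    degree (t δ * f - f * t δ) < n := by
  rw [degree_lt_iff] at hf ⊢
  intro m hm
  rw [coeff_t_mul_sub_mul_t, hf m hm, map_zero]

section Characteristic

variable (p : ℕ) [CharP D p]

theorem t_pow_char_mul_const [Fact p.Prime] (y : D) :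
    t δ ^ p * const δ y = const δ y * t δ ^ p + const δ (δ^[p] y) := by
  have := charP_of_charP (δ := δ) p
  have h := pow_char_mul_sub_mul_pow_char p (t δ) (t δ) (const δ y)
  have hit : ∀ n : ℕ, (fun v => t δ * v - v * t δ)^[n] (const δ y) = const δ (δ^[n] y) := by
    intro n
    induction n with
    | zero => rfl
    | succ n ih =>
      rw [Function.iterate_succ_apply', ih, Function.iterate_succ_apply', t_mul_const,
        add_sub_cancel_left]
  rw [hit, sub_eq_iff_eq_add'] at h
  exact h

/-- Iterating `v ↦ (t - α) v - v t` from `1` never leaves `D`, as a constant `w` goes to `δ w - α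
w`. So `(t - α)^p - t^p` is a constant, which `V` reads off. -/
theorem sub_const_pow_char [Fact p.Prime] (α : D) :
    (t δ - const δ α) ^ p = t δ ^ p - const δ (V δ p α) := by
  have := charP_of_charP (δ := δ) p
  have h := pow_char_mul_sub_mul_pow_char p (t δ - const δ α) (t δ) (const δ 1)
  have hit : ∀ n : ℕ, ∃ w, (fun v => (t δ - const δ α) * v - v * t δ)^[n] (const δ 1) =
      const δ w := by
    intro n
    induction n with
    | zero => exact ⟨1, rfl⟩
    | succ n ih =>
      obtain ⟨w, hw⟩ := ih
      refine ⟨δ w - α * w, ?_⟩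
      rw [Function.iterate_succ_apply', hw, sub_mul, t_mul_const, map_sub, map_mul]
      abel
  obtain ⟨w, hw⟩ := hit p
  rw [hw, map_one, mul_one, one_mul] at h
  have hV : V δ p α = -w := by
    have : t δ ^ p - (t δ - const δ α) ^ p = const δ (-w) := by
      rw [map_neg, ← h, neg_sub]
    rw [V, this]
    exact coeff_C_zero
  rw [hV, map_neg, ← h]
  abel

/-- If no nonzero multiple of `δ` over `F` is inner, a central element of degree `< p` is a
constant from `F`. -/
theorem exists_eq_const_of_mem_center
    (hδ : ∀ r : δ.centralConstants, r ≠ 0 → ∀ e : D, ¬ ∀ x, r * δ x = e * x - x * e)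
    {q : DiffPoly δ} (hq : q ∈ Subring.center (DiffPoly δ)) (hd : degree q < p) :
    ∃ b : δ.centralConstants, q = const δ b := by
  rw [Subring.mem_center_iff] at hq
  have hconst : ∀ n, δ (coeff q n) = 0 := fun n => by
    rw [← coeff_t_mul_sub_mul_t, hq, sub_self, coeff, map_zero, Polynomial.coeff_zero]
  have hlead : coeff q (natDegree q) ∈ Subring.center D := by
    rw [Subring.mem_center_iff]
    intro y
    rw [← coeff_mul_const_of_natDegree_le le_rfl, ← hq, coeff_const_mul]
  rcases hn : natDegree q with _ | k
  · rw [hn] at hlead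
    exact ⟨⟨coeff q 0, hlead, hconst 0⟩, eq_const_of_natDegree hn⟩
  · exfalso
    have hq0 : q ≠ 0 := by
      rintro rfl
      have : natDegree (0 : DiffPoly δ) = 0 := by rw [natDegree, map_zero, natDegree_zero]
      omega
    have hkp : k + 1 < p := by
      rw [degree_eq_natDegree' hq0, hn] at hd
      exact_mod_cast hd
    rw [hn] at hlead
    -- This is where degree less than `p` enters: the factor `k + 1` stays invertible in
    -- characteristic `p`.
    have hk0 : ((k + 1 : ℕ) : D) ≠ 0 := fun h0 => by
      rw [CharP.cast_eq_zero_iff D p] at h0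
      exact absurd (Nat.le_of_dvd (by omega) h0) (by omega)
    have hl0 : coeff q (k + 1) ≠ 0 := hn ▸ coeff_natDegree_ne_zero hq0
    let b : δ.centralConstants := ⟨coeff q (k + 1), hlead, hconst _⟩
    let r : δ.centralConstants := b * (k + 1 : ℕ)
    have hrD : (r : D) = coeff q (k + 1) * (k + 1 : ℕ) := by
      show (b : D) * (((k + 1 : ℕ) : δ.centralConstants) : D) = _
      congr 1
    -- The coefficient of `t^k` in `y q = q y` says that `(k+1) q_{k+1} δ(y) = y q_k - q_k y`, so
    -- `-q_k` is the implementing element.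
    refine hδ r (fun h0 => mul_ne_zero hl0 hk0 ?_) (-coeff q k) fun y => ?_
    · rw [← hrD, h0]
      rfl
    · have h := coeff_mul_const q hn.le y
      rw [← hq, coeff_const_mul] at h
      rw [hrD, mul_assoc, neg_mul, mul_neg, sub_neg_eq_add, neg_add_eq_sub, h, add_sub_cancel_left]

end Characteristic

/-! ### The central simple quotient `R/Rh`. -/

section CentralQuotient

variable {p : ℕ} {h : DiffPoly δ}

/-- `R h` is a maximal two-sided ideal when all central elements of degree less than that of `h`
are constants. -/
theorem one_mem_of_notMem_span
    (hd : degree h = p)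
    (hδ : ∀ q ∈ Subring.center (DiffPoly δ), degree q < p →
      ∃ b : δ.centralConstants, q = const δ b)
    (I : TwoSidedIdeal (DiffPoly δ)) (hhI : h ∈ I) {q : DiffPoly δ}
    (hq : q ∈ I) (hqh : q ∉ Ideal.span {h}) : (1 : DiffPoly δ) ∈ I := by
  have hh0 : h ≠ 0 := by
    rintro rfl
    rw [degree_eq_bot'.mpr rfl] at hd
    exact absurd hd.symm (WithBot.coe_ne_bot)
  obtain ⟨k, r, hkr, hr⟩ := exists_eq_mul_add hh0 q
  have hr0 : r ≠ 0 := by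
    rintro rfl
    rw [add_zero] at hkr
    exact hqh (Ideal.mem_span_singleton'.mpr ⟨k, hkr.symm⟩)
  have hrI : r ∈ I := by
    have : r = q - k * h := by rw [hkr, add_sub_cancel_left]
    rw [this]
    exact I.sub_mem hq (I.mul_mem_left _ _ hhI)
  obtain ⟨u, hu, hspan, hmin⟩ := exists_monic_span_eq (J := I.asIdeal)
    (fun hbot => hr0 ((Submodule.mem_bot _).mp (hbot ▸ TwoSidedIdeal.mem_asIdeal.mpr hrI)))
  have huI : u ∈ I := by
    rw [← TwoSidedIdeal.mem_asIdeal, hspan]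
    exact Ideal.mem_span_singleton_self u
  have hzero : ∀ v ∈ I, (∀ m, natDegree u ≤ m → coeff v m = 0) → v = 0 := by
    intro v hv hm
    by_contra hv0
    exact coeff_natDegree_ne_zero hv0
      (hm _ (hmin v (TwoSidedIdeal.mem_asIdeal.mpr hv) hv0))
  have hlead : coeff u (natDegree u) = 1 := hu
  -- The commutators of the monic `u` with `t` and with constants lie in `I` and have smaller degree
  -- than `u`, so they vanish by minimality. Then `u`, of degree less than `p`, is a nonzero element
  -- of `F`.
  have huc : u ∈ Subring.center (DiffPoly δ) := by
    refine mem_center_of_commute (sub_eq_zero.mp (hzero _ ?_ fun m hm => ?_)) fun y =>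
      sub_eq_zero.mp (hzero _ ?_ fun m hm => ?_)
    · exact I.sub_mem (I.mul_mem_left _ _ huI) (I.mul_mem_right _ _ huI)
    · rw [coeff_t_mul_sub_mul_t]
      rcases hm.eq_or_lt with rfl | hm
      · rw [hlead, δ.map_one_eq_zero]
      · rw [natDegree_le_iff.mp le_rfl m hm, map_zero]
    · exact I.sub_mem (I.mul_mem_left _ _ huI) (I.mul_mem_right _ _ huI)
    · rw [coeff_sub', coeff_const_mul, coeff_mul_const_of_natDegree_le hm]
      rcases hm.eq_or_lt with rfl | hm
      · rw [hlead, mul_one, one_mul, sub_self]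
      · rw [natDegree_le_iff.mp le_rfl m hm, mul_zero, zero_mul, sub_self]
  have hdu : degree u < p := by
    have h1 := hmin r (TwoSidedIdeal.mem_asIdeal.mpr hrI) hr0
    refine lt_of_le_of_lt ?_ (hd ▸ hr)
    rw [degree_eq_natDegree' hu.ne_zero', degree_eq_natDegree' hr0]
    exact_mod_cast h1
  obtain ⟨b, rfl⟩ := hδ u huc hdu
  have hb : (b : D) ≠ 0 := fun h0 => hu.ne_zero' (by rw [h0, map_zero])
  rw [← map_one (const δ), ← inv_mul_cancel₀ hb, map_mul]
  exact I.mul_mem_left _ _ huI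

theorem exists_mul_notMem_span
    (hh : h ∈ Subring.center (DiffPoly δ)) (hd : degree h = p)
    (hδ : ∀ q ∈ Subring.center (DiffPoly δ), degree q < p →
      ∃ b : δ.centralConstants, q = const δ b)
    {f q : DiffPoly δ} (hf : (1 : DiffPoly δ) ∉ Ideal.span {f})
    (hhf : h ∈ Ideal.span {f}) (hq : q ∉ Ideal.span {h}) : ∃ v, q * v ∉ Ideal.span {f} := by
  by_contra! hall
  -- `I` is the annihilator of the module `R/Rf`. It contains `h`, so by maximality it cannot
  -- contain anything outside `R h`.
  let I : TwoSidedIdeal (DiffPoly δ) := TwoSidedIdeal.mk' {x | ∀ v, x * v ∈ Ideal.span {f}}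
    (fun v => by rw [zero_mul]; exact zero_mem _)
    (fun hx hy v => by rw [add_mul]; exact add_mem (hx v) (hy v))
    (fun hx v => by rw [neg_mul]; exact neg_mem (hx v))
    (fun hy v => by rw [mul_assoc]; exact Ideal.mul_mem_left _ _ (hy v))
    (fun hx v => by rw [mul_assoc]; exact hx _)
  have hI : ∀ x, x ∈ I ↔ ∀ v, x * v ∈ Ideal.span {f} := fun x => by
    rw [TwoSidedIdeal.mem_mk']
    rfl
  have h1 := one_mem_of_notMem_span hd hδ I ((hI h).mpr fun v => by
    rw [← Subring.mem_center_iff.mp hh v]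
    exact Ideal.mul_mem_left _ _ hhf) ((hI q).mpr hall) hq
  have := (hI 1).mp h1 1
  rw [mul_one] at this
  exact hf this

/-- The eigenring of a proper right divisor of `h` is a central simple algebra over `F`, when
`h` is central and all central elements of degree less than that of `h` are constants. -/
theorem isGeneralisedAPolynomial_of_mem_span
    (hh : h ∈ Subring.center (DiffPoly δ)) (hd : degree h = p)
    (hδ : ∀ q ∈ Subring.center (DiffPoly δ), degree q < p →
      ∃ b : δ.centralConstants, q = const δ b)
    [Module.Finite δ.centralConstants D]
    {f : DiffPoly δ} (hf : (1 : DiffPoly δ) ∉ Ideal.span {f}) (hhf : h ∈ Ideal.span {f}) :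
    IsGeneralisedAPolynomial f := by
  have hh' := Subring.mem_center_iff.mp hh
  have hh0 : h ≠ 0 := by
    rintro rfl
    rw [degree_eq_bot'.mpr rfl] at hd
    exact absurd hd.symm (WithBot.coe_ne_bot)
  have hred : ∀ q : DiffPoly δ, ∃ r, degree r < p ∧ q - r ∈ Ideal.span {h} := fun q => by
    obtain ⟨k, r, hkr, hr⟩ := exists_eq_mul_add hh0 q
    refine ⟨r, hd ▸ hr, ?_⟩
    rw [hkr, add_sub_cancel_right]
    exact Ideal.mul_mem_left _ _ (Ideal.mem_span_singleton_self h)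
  have hts : (Ideal.span {h}).IsTwoSided := ⟨fun {x} y hx => by
    obtain ⟨r, rfl⟩ := Ideal.mem_span_singleton'.mp hx
    rw [mul_assoc, ← hh', ← mul_assoc]
    exact Ideal.mul_mem_left _ _ (Ideal.mem_span_singleton_self h)⟩
  let A := DiffPoly δ ⧸ Ideal.span {h}
  let π : DiffPoly δ →ₐ[δ.centralConstants] A := Ideal.Quotient.mkₐ _ _
  have hπ : Function.Surjective π := Ideal.Quotient.mk_surjective
  have hπ0 : ∀ x, π x = 0 ↔ x ∈ Ideal.span {h} := fun x => Ideal.Quotient.eq_zero_iff_mem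
  have hle : Ideal.span {h} ≤ Ideal.span {f} := by
    rw [Ideal.span_le, Set.singleton_subset_iff]
    exact hhf
  have hnt : Nontrivial A := ⟨⟨π 1, 0, fun h0 => hf (hle ((hπ0 1).mp h0))⟩⟩
  have hsimple : IsSimpleRing A := by
    refine .of_eq_bot_or_eq_top fun I => ?_
    rw [or_iff_not_imp_left]
    intro hI
    obtain ⟨x, hxI, hx0⟩ := SetLike.exists_of_lt (bot_lt_iff_ne_bot.mpr hI)
    obtain ⟨q, rfl⟩ := hπ x
    have h1 := one_mem_of_notMem_span hd hδ (I.comap π)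
      ((TwoSidedIdeal.mem_comap π).mpr (by
        rw [(hπ0 h).mpr (Ideal.mem_span_singleton_self h)]; exact I.zero_mem))
      ((TwoSidedIdeal.mem_comap π).mpr hxI)
      (fun hq => hx0 ((TwoSidedIdeal.mem_bot _).mpr ((hπ0 q).mpr hq)))
    rw [← I.one_mem_iff, ← map_one π]
    exact (TwoSidedIdeal.mem_comap π).mp h1
  have hcentral : Algebra.IsCentral δ.centralConstants A := by
    refine ⟨fun x hx => ?_⟩
    obtain ⟨q, rfl⟩ := hπ x
    obtain ⟨r, hr, hqr⟩ := hred q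
    have hπr : π q = π r := by
      rw [← sub_eq_zero, ← map_sub]
      exact (hπ0 _).mpr hqr
    rw [hπr] at hx ⊢
    rw [Subalgebra.mem_center_iff] at hx
    have hmem : ∀ y, y * r - r * y ∈ Ideal.span {h} := fun y => by
      rw [← hπ0, map_sub, map_mul, map_mul, hx, sub_self]
    -- The reduced representative of a central class is itself central: its commutators lie in `R h`
    -- but have degree below that of `h`.
    have hrc : r ∈ Subring.center (DiffPoly δ) := by
      refine mem_center_of_commute (sub_eq_zero.mp ?_) fun y => sub_eq_zero.mp ?_
      · exact eq_zero_of_mem_span_of_degree_lt (hmem _) (hd ▸ degree_t_mul_sub_mul_t_lt hr)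
      · exact eq_zero_of_mem_span_of_degree_lt (hmem _)
          (hd ▸ degree_sub_lt_of_lt (degree_const_mul_lt hr y) (degree_mul_const_lt hr y))
    obtain ⟨b, rfl⟩ := hδ r hrc hr
    exact Algebra.mem_bot.mpr ⟨b, rfl⟩
  have hfinite : Module.Finite δ.centralConstants A := by
    -- Remainders modulo `h` have `p` coefficients in `D`, so `D^p` maps onto `A`.
    let φ : (Fin p → D) →ₗ[δ.centralConstants] DiffPoly δ :=
      { toFun := fun v => ∑ i : Fin p, const δ (v i) * t δ ^ (i : ℕ)
        map_add' := fun v w => by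
          simp only [Pi.add_apply, map_add, add_mul, Finset.sum_add_distrib]
        map_smul' := fun a v => by
          rw [RingHom.id_apply, Finset.smul_sum]
          refine Finset.sum_congr rfl fun i _ => ?_
          rw [Algebra.smul_def, ← mul_assoc]
          congr 1
          exact map_mul (const δ) (a : D) (v i) }
    refine Module.Finite.of_surjective (π.toLinearMap ∘ₗ φ) fun x => ?_
    obtain ⟨q, rfl⟩ := hπ x
    obtain ⟨r, hr, hqr⟩ := hred q
    refine ⟨fun i => coeff r i, ?_⟩
    have hφr : φ (fun i => coeff r i) = r := by
      show ∑ i : Fin p, const δ (coeff r i) * t δ ^ (i : ℕ) = r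
      apply toPoly.injective
      rw [map_sum]
      simp only [toPoly_const_mul_t_pow]
      rw [Fin.sum_univ_eq_sum_range (fun i => monomial i (coeff r i)) p]
      ext m
      rw [finsetSum_coeff]
      simp only [coeff_monomial, Finset.sum_ite_eq', Finset.mem_range]
      split_ifs with hm
      · rfl
      · exact (degree_lt_iff.mp hr m (by omega)).symm
    show π (φ _) = π q
    rw [hφr, ← sub_eq_zero, ← map_sub, ← neg_sub, map_neg, (hπ0 _).mpr hqr, neg_zero]
  have hart : IsArtinianRing A := IsArtinianRing.of_finite δ.centralConstants A
  have hss : IsSemisimpleRing A := IsSimpleRing.isSemisimpleRing_iff_isArtinianRing.mpr hart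
  have hker : ∀ x, π x = 0 → x ∈ Ideal.span {f} := fun x hx => hle ((hπ0 x).mp hx)
  exact ⟨isSimpleRing_eigenring π f hπ hker hf, isCentral_eigenring π f hπ hker hf,
    finite_eigenring π f hπ hker⟩

end CentralQuotient

end DiffPoly

/-! ### Right divisors of a central element. -/

namespace DiffPoly

variable {D : Type*} [DivisionRing D] {δ : RingDer D}

section Factorisation

/-- Thus left factors of `h` are also right factors, which lets inductions continue on the cofactor
after a right factor is removed. -/
theorem mul_comm_of_mem_center {h u w : DiffPoly δ} (hh : h ∈ Subring.center (DiffPoly δ))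
    (huw : h = u * w) : h = w * u := by
  by_cases hu : u = 0
  · rw [huw, hu, zero_mul, mul_zero]
  · refine mul_left_cancel₀ hu ?_
    rw [← mul_assoc, ← huw, Subring.mem_center_iff.mp hh]

variable {p : ℕ} {h : DiffPoly δ}

/-- A nonconstant right divisor of the central element `h` has a right factor of degree at most
that of any given nonconstant right divisor `f₀` of `h`, which annihilates an element of
`R / R f₀`. -/
theorem exists_right_factor
    (hh : h ∈ Subring.center (DiffPoly δ)) (hd : degree h = p)
    (hδ : ∀ q ∈ Subring.center (DiffPoly δ), degree q < p →
      ∃ b : δ.centralConstants, q = const δ b)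
    {f₀ f : DiffPoly δ} (hf₀ : 1 ≤ natDegree f₀)
    (hhf₀ : h ∈ Ideal.span {f₀}) (hf : 1 ≤ natDegree f) (hhf : h ∈ Ideal.span {f}) :
    ∃ g : DiffPoly δ, g.Monic ∧ f ∈ Ideal.span {g} ∧ 1 ≤ natDegree g ∧
      natDegree g ≤ natDegree f₀ ∧ ∃ s ∉ Ideal.span {f₀}, g * s ∈ Ideal.span {f₀} := by
  have hh0 : h ≠ 0 := by
    rintro rfl
    rw [degree_eq_bot'.mpr rfl] at hd
    exact absurd hd.symm (WithBot.coe_ne_bot)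
  obtain ⟨q, hq⟩ := Ideal.mem_span_singleton'.mp hhf
  have hfq := mul_comm_of_mem_center hh hq.symm
  have hq0 : q ≠ 0 := by rintro rfl; exact hh0 (by rw [← hq, zero_mul])
  have hf0 : f ≠ 0 := by rintro rfl; exact hh0 (by rw [← hq, mul_zero])
  have hf₀ne : f₀ ≠ 0 := by
    rintro rfl
    obtain ⟨k, hk⟩ := Ideal.mem_span_singleton'.mp hhf₀
    exact hh0 (by rw [← hk, mul_zero])
  have hqh : q ∉ Ideal.span {h} := fun hmem => hq0 (eq_zero_of_mem_span_of_degree_lt hmem (by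
    have := (natDegree_mul' hq0 hf0).2
    rw [hq] at this
    rw [degree_eq_natDegree' hq0, degree_eq_natDegree' hh0]
    exact_mod_cast (by omega : natDegree q < natDegree h)))
  -- With `h = f q`, some `q v` is nonzero in `R/Rf₀` by faithfulness, and `f` kills it because `f q
  -- v = h v = v h`. The generator `g` of its annihilator `J` is the desired right factor of `f`.
  obtain ⟨v, hv⟩ := exists_mul_notMem_span hh hd hδ (one_notMem_span hf₀) hhf₀ hqh
  let J : Ideal (DiffPoly δ) :=
    Submodule.comap (LinearMap.toSpanSingleton (DiffPoly δ) (DiffPoly δ) (q * v)) (Ideal.span {f₀})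
  have hJ : ∀ r, r ∈ J ↔ r * (q * v) ∈ Ideal.span {f₀} := fun r => Iff.rfl
  have hfJ : f ∈ J := by
    rw [hJ, ← mul_assoc, ← hfq, ← Subring.mem_center_iff.mp hh]
    exact Ideal.mul_mem_left _ _ hhf₀
  obtain ⟨g, hg, hspan, hmin⟩ := exists_monic_span_eq (J := J)
    (fun hbot => hf0 ((Submodule.mem_bot _).mp (hbot ▸ hfJ)))
  have hgJ : g ∈ J := hspan ▸ Ideal.mem_span_singleton_self g
  -- A common left multiple of `f₀` and `q v` gives a nonzero `u` in `J` of degree at most that of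
  -- `f₀`, bounding the degree of `g`.
  obtain ⟨u, w, hu0, huw, hud, -⟩ := exists_mul_eq_mul (natDegree (q * v) + 1) f₀ (q * v)
    (degree_lt_iff.mpr fun m hm => natDegree_le_iff.mp le_rfl m hm) hf₀ne
  have huJ : u ∈ J := by
    rw [hJ, huw]
    exact Ideal.mul_mem_left _ _ (Ideal.mem_span_singleton_self f₀)
  refine ⟨g, hg, hspan ▸ hfJ, ?_, ?_, q * v, hv, (hJ g).mp hgJ⟩
  · rw [Nat.one_le_iff_ne_zero]
    intro h0
    have hc := eq_const_of_natDegree h0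
    have h1 : coeff g (natDegree g) = 1 := hg
    rw [h0] at h1
    rw [h1, map_one] at hc
    rw [hc, hJ, one_mul] at hgJ
    exact hv hgJ
  · refine (hmin u huJ hu0).trans ?_
    rw [degree_eq_natDegree' hu0, degree_eq_natDegree' hf₀ne] at hud
    exact_mod_cast hud

/-- The least degree of a nonconstant right divisor of `h` divides the degree of every right
divisor of `h`. -/
theorem natDegree_dvd_of_minimal
    (hh : h ∈ Subring.center (DiffPoly δ)) (hd : degree h = p)
    (hδ : ∀ q ∈ Subring.center (DiffPoly δ), degree q < p →
      ∃ b : δ.centralConstants, q = const δ b)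
    {f₀ : DiffPoly δ} (hf₀ : 1 ≤ natDegree f₀)
    (hhf₀ : h ∈ Ideal.span {f₀})
    (hmin : ∀ g : DiffPoly δ, g.Monic → 1 ≤ natDegree g → h ∈ Ideal.span {g} →
      natDegree f₀ ≤ natDegree g)
    (n : ℕ) {f : DiffPoly δ} (hfn : natDegree f = n) (hf : f.Monic) (hhf : h ∈ Ideal.span {f}) :
    natDegree f₀ ∣ natDegree f := by
  induction n using Nat.strong_induction_on generalizing f with
  | _ n ih =>
    rcases Nat.eq_zero_or_pos (natDegree f) with h0 | hpos
    · rw [h0]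
      exact dvd_zero _
    obtain ⟨g, hg, hfg, hg1, hgd, -⟩ := exists_right_factor hh hd hδ hf₀ hhf₀ hpos hhf
    obtain ⟨x, rfl⟩ := Ideal.mem_span_singleton'.mp hfg
    obtain ⟨q, hq⟩ := Ideal.mem_span_singleton'.mp hhf
    have hhg : h ∈ Ideal.span {g} := by
      rw [← hq, ← mul_assoc]
      exact Ideal.mul_mem_left _ _ (Ideal.mem_span_singleton_self g)
    have hx : x.Monic := hg.of_mul_right hf
    have hhx : h ∈ Ideal.span {x} := by
      rw [mul_comm_of_mem_center (u := q * x) (w := g) hh (by rw [mul_assoc, hq]), ← mul_assoc]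
      exact Ideal.mul_mem_left _ _ (Ideal.mem_span_singleton_self x)
    -- The split-off factor has exactly the minimal degree, so strong induction on the cofactor `x`
    -- applies.
    have hgeq : natDegree g = natDegree f₀ := le_antisymm hgd (hmin g hg hg1 hhg)
    have hdeg := (natDegree_mul' hx.ne_zero' hg.ne_zero').2
    rw [hdeg, hgeq]
    exact dvd_add (ih _ (by omega) rfl hx hhx) dvd_rfl

theorem eq_t_sub_const_of_natDegree_eq_one {f : DiffPoly δ} (hf : f.Monic)
    (h1 : natDegree f = 1) : ∃ β, f = t δ - const δ β := by
  refine ⟨-coeff f 0, toPoly.injective ?_⟩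
  have hl : (toPoly f).coeff 1 = 1 := by
    have : (toPoly f).coeff (natDegree f) = 1 := hf
    rwa [h1] at this
  rw [map_neg, sub_neg_eq_add, map_add, eq_X_add_C_of_natDegree_le_one h1.le, hl, map_one, one_mul]
  rfl

theorem monic_t_sub_const (α : D) : (t δ - const δ α).Monic := by
  have : toPoly (t δ - const δ α) = X - Polynomial.C α := by
    rw [map_sub]
    rfl
  rw [Monic, this]
  exact Polynomial.monic_X_sub_C α

theorem natDegree_t_sub_const (α : D) : natDegree (t δ - const δ α) = 1 := by
  have : toPoly (t δ - const δ α) = X - Polynomial.C α := by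
    rw [map_sub]
    rfl
  rw [natDegree, this]
  exact Polynomial.natDegree_X_sub_C α

theorem degree_t_sub_const (α : D) : degree (t δ - const δ α) = 1 := by
  rw [degree_eq_natDegree' (monic_t_sub_const α).ne_zero', natDegree_t_sub_const]
  rfl

theorem const_mem_span_t_sub_const {α k : D} :
    const δ k ∈ Ideal.span {t δ - const δ α} ↔ k = 0 := by
  constructor
  · intro hk
    have h0 := eq_zero_of_mem_span_of_degree_lt hk (by
      rw [degree_t_sub_const]
      exact (degree_const_le k).trans_lt zero_lt_one)
    exact const_injective (by rw [h0, map_zero])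
  · rintro rfl
    rw [map_zero]
    exact zero_mem _

/-- If `t - β` annihilates a nonzero element of `R / R (t - α)`, then `β = Ω_v(α)` for some
`v ≠ 0`. -/
theorem exists_eq_Omega {α β : D} {s : DiffPoly δ} (hs : s ∉ Ideal.span {t δ - const δ α})
    (hβ : (t δ - const δ β) * s ∈ Ideal.span {t δ - const δ α}) :
    ∃ v ≠ 0, β = Omega δ v α := by
  obtain ⟨q, r, hqr, hr⟩ := exists_eq_mul_add (monic_t_sub_const α).ne_zero' s
  have hr0 : natDegree r = 0 := by
    have : degree r < (1 : ℕ) := by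
      rw [degree_t_sub_const] at hr
      exact hr
    rw [degree_lt_iff] at this
    exact Nat.le_zero.mp (natDegree_le_iff.mpr fun m hm => this m hm)
  obtain ⟨v, rfl⟩ : ∃ v, r = const δ v := ⟨_, eq_const_of_natDegree hr0⟩
  have hv : v ≠ 0 := by
    rintro rfl
    rw [map_zero, add_zero] at hqr
    exact hs (Ideal.mem_span_singleton'.mpr ⟨q, hqr.symm⟩)
  refine ⟨v, hv, ?_⟩
  -- Modulo `t - α` only the constant remainder `v` of `s` counts, and `(t - β) v = v (t - α) + (vα
  -- + δ(v) - βv)`. Vanishing of the constant is `β = Ω_v(α)`.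
  have hsplit : (t δ - const δ β) * s =
      ((t δ - const δ β) * q + const δ v) * (t δ - const δ α) +
        const δ (v * α + δ v - β * v) := by
    rw [hqr, mul_add, add_mul, ← mul_assoc, sub_mul (t δ) _ (const δ v), t_mul_const, map_sub,
      map_add, map_mul, map_mul, mul_sub (const δ v)]
    abel
  rw [hsplit, Ideal.add_mem_iff_right _
    (Ideal.mul_mem_left _ _ (Ideal.mem_span_singleton_self _)), const_mem_span_t_sub_const,
    sub_eq_zero] at hβ
  rw [Omega, ← add_mul, hβ, mul_inv_cancel_right₀ hv]

/-- If `t - α` is a right factor of `h`, then every nonconstant right divisor of `h` has a right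
factor `t - Ω_v(α)`. -/
theorem exists_eq_mul_t_sub_Omega
    (hh : h ∈ Subring.center (DiffPoly δ)) (hd : degree h = p)
    (hδ : ∀ q ∈ Subring.center (DiffPoly δ), degree q < p →
      ∃ b : δ.centralConstants, q = const δ b)
    {α : D} (hα : h ∈ Ideal.span {t δ - const δ α})
    {f : DiffPoly δ} (hfm : f.Monic) (hf : 1 ≤ natDegree f) (hhf : h ∈ Ideal.span {f}) :
    ∃ v ≠ 0, ∃ x : DiffPoly δ, x.Monic ∧ f = x * (t δ - const δ (Omega δ v α)) ∧
      natDegree f = natDegree x + 1 ∧ h ∈ Ideal.span {x} ∧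
      h ∈ Ideal.span {t δ - const δ (Omega δ v α)} := by
  obtain ⟨g, hg, hfg, hg1, hgd, s, hs, hgs⟩ := exists_right_factor hh hd hδ
    (natDegree_t_sub_const α).ge hα hf hhf
  rw [natDegree_t_sub_const] at hgd
  obtain ⟨β, rfl⟩ := eq_t_sub_const_of_natDegree_eq_one hg (le_antisymm hgd hg1)
  obtain ⟨v, hv, rfl⟩ := exists_eq_Omega hs hgs
  obtain ⟨x, rfl⟩ := Ideal.mem_span_singleton'.mp hfg
  obtain ⟨q, hq⟩ := Ideal.mem_span_singleton'.mp hhf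
  have hx := hg.of_mul_right hfm
  refine ⟨v, hv, x, hx, rfl, ?_, ?_, ?_⟩
  · rw [(natDegree_mul' hx.ne_zero' hg.ne_zero').2, natDegree_t_sub_const]
  · rw [← mul_assoc] at hq
    rw [mul_comm_of_mem_center hh hq.symm, ← mul_assoc]
    exact Ideal.mul_mem_left _ _ (Ideal.mem_span_singleton_self x)
  · rw [← hq, ← mul_assoc]
    exact Ideal.mul_mem_left _ _ (Ideal.mem_span_singleton_self _)

theorem exists_list_prod_t_sub_Omega
    (hh : h ∈ Subring.center (DiffPoly δ)) (hd : degree h = p)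
    (hδ : ∀ q ∈ Subring.center (DiffPoly δ), degree q < p →
      ∃ b : δ.centralConstants, q = const δ b)
    {α : D} (hα : h ∈ Ideal.span {t δ - const δ α}) (m : ℕ)
    {f : DiffPoly δ} (hfm : f.Monic) (hf : natDegree f = m) (hhf : h ∈ Ideal.span {f}) :
    ∃ l : List D, l.length = m ∧ (∀ v ∈ l, v ≠ 0) ∧
      f = (l.map fun v => t δ - const δ (Omega δ v α)).prod := by
  induction m generalizing f with
  | zero =>
    refine ⟨[], rfl, by simp, ?_⟩
    have h1 : coeff f (natDegree f) = 1 := hfm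
    have hc := eq_const_of_natDegree hf
    rw [hf] at h1
    rw [hc, h1, map_one, List.map_nil, List.prod_nil]
  | succ m ih =>
    obtain ⟨v, hv, x, hx, hfx, hdeg, hhx, -⟩ :=
      exists_eq_mul_t_sub_Omega hh hd hδ hα hfm (by omega) hhf
    obtain ⟨l, hl, hl0, rfl⟩ := ih hx (by omega) hhx
    refine ⟨l ++ [v], by simp [hl], ?_, ?_⟩
    · intro w hw
      rcases List.mem_append.mp hw with hw | hw
      · exact hl0 w hw
      · rw [List.mem_singleton.mp hw]
        exact hv
    · rw [List.map_append, List.prod_append, List.map_singleton, List.prod_singleton, hfx]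

theorem Omega_one (α : D) : Omega δ 1 α = α := by
  rw [Omega, δ.map_one_eq_zero, inv_one, one_mul, mul_one, zero_mul, add_zero]

/-- If `h` has a linear right factor, every nonconstant right divisor of `h` is a product of
factors `t - Ω_v(α)`, of which the last is `t - α`. -/
theorem exists_eq_prod_ofFn
    (hh : h ∈ Subring.center (DiffPoly δ)) (hd : degree h = p)
    (hδ : ∀ q ∈ Subring.center (DiffPoly δ), degree q < p →
      ∃ b : δ.centralConstants, q = const δ b)
    {α₀ : D} (hα₀ : h ∈ Ideal.span {t δ - const δ α₀}) {m : ℕ}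
    (hm : 1 ≤ m) {f : DiffPoly δ} (hfm : f.Monic) (hf : natDegree f = m)
    (hhf : h ∈ Ideal.span {f}) :
    ∃ (v : Fin m → D) (α : D), (∀ i, v i ≠ 0) ∧ (∀ i : Fin m, (i : ℕ) + 1 = m → v i = 1) ∧
      f = (List.ofFn fun i => t δ - const δ (Omega δ (v i) α)).prod ∧
      h ∈ Ideal.span {t δ - const δ α} := by
  obtain ⟨v₀, -, x, hx, hfx, hdeg, hhx, hα⟩ :=
    exists_eq_mul_t_sub_Omega hh hd hδ hα₀ hfm (by omega) hhf
  obtain ⟨l, hl, hl0, hlx⟩ := exists_list_prod_t_sub_Omega hh hd hδ hα _ hx rfl hhx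
  obtain rfl : m = (l ++ [1]).length := by
    rw [List.length_append, hl, List.length_singleton]
    omega
  -- The last factor is taken as the new base point `α`, and the others are expressed relative to
  -- it; `Ω_1(α) = α` accounts for the final entry `1`.
  refine ⟨(l ++ [1]).get, Omega δ v₀ α₀, fun i => ?_, fun i hi => ?_, ?_, hα⟩
  · rcases List.mem_append.mp ((l ++ [1]).get_mem i) with hw | hw
    · exact hl0 _ hw
    · rw [List.mem_singleton.mp hw]
      exact one_ne_zero
  · have hi' : (i : ℕ) = l.length := by
      have hlen : (l ++ [1]).length = l.length + 1 := by simp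
      omega
    rw [List.get_eq_getElem]
    simp only [hi', List.getElem_concat_length]
  · have hof : (List.ofFn fun i => t δ - const δ (Omega δ ((l ++ [1]).get i) (Omega δ v₀ α₀))) =
        (l ++ [1]).map fun v => t δ - const δ (Omega δ v (Omega δ v₀ α₀)) := by
      conv_rhs => rw [← List.ofFn_get (l ++ [1]), List.map_ofFn]
      rfl
    rw [hof, List.map_append, List.prod_append, List.map_singleton, List.prod_singleton, Omega_one,
      ← hlx, hfx]

/-- If the degree of `h` is prime and `h` has no linear right factor, its only monic nonconstant
right divisor is itself. -/
theorem natDegree_eq_of_forall_notMem_span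
    (hh : h ∈ Subring.center (DiffPoly δ)) (hd : degree h = p)
    (hδ : ∀ q ∈ Subring.center (DiffPoly δ), degree q < p →
      ∃ b : δ.centralConstants, q = const δ b)
    (hp : p.Prime) (hm : h.Monic)
    (hroot : ∀ α : D, h ∉ Ideal.span {t δ - const δ α}) {f : DiffPoly δ} (hfm : f.Monic)
    (hf : 1 ≤ natDegree f) (hhf : h ∈ Ideal.span {f}) : natDegree f = p := by
  classical
  have hhp : natDegree h = p := by
    rw [degree_eq_natDegree' hm.ne_zero'] at hd
    exact_mod_cast hd
  have hex : ∃ n, ∃ g : DiffPoly δ, g.Monic ∧ 1 ≤ natDegree g ∧ h ∈ Ideal.span {g} ∧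
      natDegree g = n := ⟨_, f, hfm, hf, hhf, rfl⟩
  obtain ⟨g, hg, hg1, hhg, hgn⟩ := Nat.find_spec hex
  have hmin : ∀ f : DiffPoly δ, f.Monic → 1 ≤ natDegree f → h ∈ Ideal.span {f} →
      natDegree g ≤ natDegree f := fun f hf h1 hhf => by
    rw [hgn]
    exact Nat.find_min' hex ⟨f, hf, h1, hhf, rfl⟩
  -- Applied to `h` itself: the least degree divides the prime `p`, and the value `1` would give a
  -- linear factor.
  have hdvd := natDegree_dvd_of_minimal hh hd hδ hg1 hhg hmin _ rfl hm
    (Ideal.mem_span_singleton_self h)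
  rw [hhp] at hdvd
  rcases (Nat.dvd_prime hp).mp hdvd with h1 | h1
  · obtain ⟨β, rfl⟩ := eq_t_sub_const_of_natDegree_eq_one hg h1
    exact absurd hhg (hroot β)
  · refine le_antisymm ?_ (h1 ▸ hmin f hfm hf hhf)
    obtain ⟨q, hq⟩ := Ideal.mem_span_singleton'.mp hhf
    have hq0 : q ≠ 0 := by
      rintro rfl
      exact hm.ne_zero' (by rw [← hq, zero_mul])
    have := (natDegree_mul' hq0 hfm.ne_zero').2
    rw [hq, hhp] at this
    omega

theorem eq_of_mem_span_of_natDegree_eq {f h : DiffPoly δ} (hf : f.Monic) (hh : h.Monic)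
    (hhf : h ∈ Ideal.span {f}) (hdeg : natDegree f = natDegree h) : f = h := by
  obtain ⟨q, hq⟩ := Ideal.mem_span_singleton'.mp hhf
  have hqm : q.Monic := hf.of_mul_right (hq ▸ hh)
  have := (natDegree_mul' hqm.ne_zero' hf.ne_zero').2
  rw [hq, hdeg] at this
  have hq0 : natDegree q = 0 := by omega
  have h1 : coeff q (natDegree q) = 1 := hqm
  rw [hq0] at h1
  rw [← hq, eq_const_of_natDegree hq0, h1, map_one, one_mul]

end Factorisation

/-! ### The central elements `t^p - at - (b+c)`. -/

section Centre

variable (p : ℕ) (a : δ.centralConstants)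

theorem aeval_t_X_pow_sub (c : D) (b : δ.centralConstants) :
    aeval (t δ) (X ^ p - C a * X : (δ.centralConstants)[X]) - const δ c -
      algebraMap δ.centralConstants (DiffPoly δ) b =
        t δ ^ p - const δ a * t δ - const δ (b + c) := by
  have h : ∀ r : δ.centralConstants, algebraMap δ.centralConstants (DiffPoly δ) r = const δ r :=
    fun _ => rfl
  rw [map_sub, map_pow, map_mul, aeval_X, aeval_C, h, h, map_add]
  abel

variable [Fact p.Prime]

theorem degree_t_pow_sub (k : D) : degree (t δ ^ p - const δ a * t δ - const δ k) = p ∧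
    (t δ ^ p - const δ a * t δ - const δ k).Monic := by
  have hp : 1 < p := (Fact.out : p.Prime).one_lt
  have hpoly : toPoly (t δ ^ p - const δ a * t δ - const δ k) =
      X ^ p - (Polynomial.C (a : D) * X + Polynomial.C k) := by
    have h1 : toPoly (t δ ^ p) = X ^ p := by
      have := toPoly_const_mul_t_pow (δ := δ) 1 p
      rwa [map_one, one_mul, ← X_pow_eq_monomial] at this
    rw [map_sub, map_sub, h1, toPoly_const_mul, sub_sub]
    rfl
  have hlt : (Polynomial.C (a : D) * X + Polynomial.C k).degree < (p : WithBot ℕ) :=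
    degree_linear_le.trans_lt (by exact_mod_cast hp)
  constructor
  · rw [degree, hpoly, degree_sub_eq_left_of_degree_lt (by rwa [degree_X_pow]), degree_X_pow]
  · rw [Monic, hpoly]
    exact monic_X_pow_sub hlt

variable [CharP D p]

/-- Since `t^p = (t - α)^p + V_p(α)`, the constant on the right is the remainder on right division
by `t - α`. -/
theorem t_pow_sub_mem_span_iff (k α : D) :
    t δ ^ p - const δ a * t δ - const δ k ∈ Ideal.span {t δ - const δ α} ↔
      V δ p α - a * α - k = 0 := by
  have hp : p = p - 1 + 1 := (Nat.sub_add_cancel (Fact.out : p.Prime).one_le).symm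
  have hV := sub_const_pow_char (δ := δ) p α
  have hsplit : t δ ^ p - const δ a * t δ - const δ k =
      ((t δ - const δ α) ^ (p - 1) - const δ a) * (t δ - const δ α) +
        const δ (V δ p α - a * α - k) := by
    rw [sub_mul, ← pow_succ, ← hp, hV, mul_sub, map_sub, map_sub, map_mul]
    abel
  rw [hsplit, Ideal.add_mem_iff_right _
    (Ideal.mul_mem_left _ _ (Ideal.mem_span_singleton_self _)), const_mem_span_t_sub_const]

variable {p a} in
-- The commutator of `t^p - at` with `y` is `g(δ)(y) = [c, y]`, which subtracting `c` cancels.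
-- Commuting with `t` needs only that `a`, `b`, `c` are killed by `δ`.
theorem t_pow_sub_mem_center {c : D} (hc : ∀ x, δ^[p] x - a * δ x = c * x - x * c)
    (hδc : δ c = 0) (b : δ.centralConstants) :
    t δ ^ p - const δ a * t δ - const δ (b + c) ∈ Subring.center (DiffPoly δ) := by
  have hcomm : ∀ r : D, δ r = 0 → t δ * const δ r = const δ r * t δ := fun r hr => by
    rw [t_mul_const, hr, map_zero, add_zero]
  refine mem_center_of_commute ?_ fun y => ?_
  · rw [mul_sub, mul_sub, sub_mul, sub_mul, ← pow_succ, ← pow_succ', ← mul_assoc,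
      hcomm a a.2.2, hcomm (b + c) (by rw [map_add, hδc, add_zero]; exact b.2.2)]
  · have h1 := t_pow_char_mul_const (δ := δ) p y
    have h2 : const δ a * t δ * const δ y = const δ y * (const δ a * t δ) + const δ (a * δ y) := by
      rw [mul_assoc, t_mul_const, mul_add, ← mul_assoc, const_mul_comm, mul_assoc, map_mul]
    have h3 : (b + c : D) * y = y * (b + c) + (δ^[p] y - a * δ y) := by
      rw [hc, add_mul, mul_add, δ.commute_of_mem_centralConstants]
      abel
    rw [mul_sub, mul_sub, sub_mul, sub_mul, h1, h2, ← map_mul, ← map_mul, h3, map_add, map_sub]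
    abel

end Centre

end DiffPoly

/-! ### Scalars from a central eigenring, and the main theorem. -/

namespace DiffPoly

variable {D : Type*} [DivisionRing D] {δ : RingDer D}

/-- A central element of `R` acts on a central eigenring as a scalar. -/
theorem exists_sub_algebraMap_mem_span {k R : Type*} [Field k] [Ring R] [Algebra k R] {f z : R}
    [Algebra.IsCentral k (Eigenring k f)] (hz : z ∈ Subring.center R) :
    ∃ b : k, z - algebraMap k R b ∈ Ideal.span {f} := by
  have hzf : z ∈ leftIdealiser k f := by
    show f * z ∈ Ideal.span {f}
    rw [Subring.mem_center_iff.mp hz]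
    exact Ideal.mul_mem_left _ _ (Ideal.mem_span_singleton_self f)
  have hmem : Ideal.Quotient.mk (eigenIdeal k f) ⟨z, hzf⟩ ∈
      Subalgebra.center k (Eigenring k f) := by
    rw [Subalgebra.mem_center_iff]
    intro y
    obtain ⟨y, rfl⟩ := Ideal.Quotient.mk_surjective y
    rw [← map_mul, ← map_mul]
    exact congrArg _ (Subtype.ext (Subring.mem_center_iff.mp hz y))
  obtain ⟨b, hb⟩ := Algebra.mem_bot.mp (Algebra.IsCentral.out hmem)
  have hb' : Ideal.Quotient.mk (eigenIdeal k f) (algebraMap k _ b) =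
      Ideal.Quotient.mk (eigenIdeal k f) ⟨z, hzf⟩ := hb
  exact ⟨b, (mk_eigenring_eq_iff f).mp hb'.symm⟩

/-- If `ĥ(z)` and `z - b` lie in a proper left ideal and `ĥ` is irreducible and monic, then
`ĥ = x - b`. -/
theorem eq_X_sub_C_of_aeval_mem {k R : Type*} [Field k] [Ring R] [Algebra k R] {J : Ideal R}
    (hJ : (1 : R) ∉ J) {z : R} {b : k} (hb : z - algebraMap k R b ∈ J) {P : k[X]} (hP : P.Monic)
    (hirr : Irreducible P) (hPz : aeval z P ∈ J) : P = X - C b := by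
  obtain ⟨Q, hQ⟩ := X_sub_C_dvd_sub_C_eval (a := b) (p := P)
  -- `P - P(b)` is a multiple of `x - b`, so a nonzero `P(b)` would be a unit in the proper left
  -- ideal `J`.
  have h0 : P.eval b = 0 := by
    by_contra hne
    have hz : aeval z P - algebraMap k R (P.eval b) = aeval z Q * (z - algebraMap k R b) := by
      have := congrArg (aeval z) (hQ.trans (mul_comm _ _))
      simpa only [map_sub, map_mul, aeval_C, aeval_X] using this
    have h1 : algebraMap k R (P.eval b) ∈ J := by
      have h2 : aeval z P - algebraMap k R (P.eval b) ∈ J := by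
        rw [hz]
        exact J.mul_mem_left _ hb
      have h3 := J.sub_mem hPz h2
      rwa [sub_sub_cancel] at h3
    refine hJ ?_
    rw [← map_one (algebraMap k R), ← inv_mul_cancel₀ hne, map_mul]
    exact J.mul_mem_left _ h1
  have hdvd : X - C b ∣ P := dvd_iff_isRoot.mpr h0
  exact (eq_of_monic_of_associated (monic_X_sub_C b) hP
    ((irreducible_X_sub_C b).associated_of_dvd hirr hdvd)).symm

theorem irreducible_of_natDegree_eq {f : DiffPoly δ} (hf : 1 ≤ natDegree f)
    (hdiv : ∀ g : DiffPoly δ, g.Monic → 1 ≤ natDegree g → f ∈ Ideal.span {g} →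
      natDegree g = natDegree f) : Irreducible f := by
  have hf0 : f ≠ 0 := by
    rintro rfl
    have : natDegree (0 : DiffPoly δ) = 0 := by rw [natDegree, map_zero, natDegree_zero]
    omega
  refine ⟨fun hu => ?_, fun u v huv => ?_⟩
  · obtain ⟨w, hw⟩ := hu.exists_left_inv
    exact one_notMem_span hf (Ideal.mem_span_singleton'.mpr ⟨w, hw⟩)
  · subst huv
    have hu0 := left_ne_zero_of_mul hf0
    have hv0 := right_ne_zero_of_mul hf0
    rcases Nat.eq_zero_or_pos (natDegree v) with h0 | hpos
    · exact Or.inr (isUnit_of_natDegree_eq_zero hv0 h0)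
    · obtain ⟨w, hw, hmon, hdeg⟩ := exists_monic_const_mul hv0
      have h1 := hdiv _ hmon (by omega) (Ideal.mem_span_singleton'.mpr ⟨u * const δ w⁻¹, by
        rw [mul_assoc, ← mul_assoc (const δ w⁻¹), ← map_mul, inv_mul_cancel₀ hw, map_one,
          one_mul]⟩)
      rw [(natDegree_mul' hu0 hv0).2] at h1
      exact Or.inl (isUnit_of_natDegree_eq_zero hu0 (by omega))

end DiffPoly

open DiffPoly in
theorem theorem5 {D : Type*} [DivisionRing D]
    -- `D` has finite dimension over its centre, and prime characteristic `p`
    [Module.Finite (Subring.center D) D]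
    (p : ℕ) [Fact p.Prime] [CharP D p]
    -- `g = xᵖ - a x` is the minimum polynomial of `δ`, and `g(δ) = δ_c`, with `δ(c) = 0`
    (δ : RingDer D) (a : δ.centralConstants) (c : D)
    (hg : δ.IsMinimumPolynomial (X ^ p - C a * X))
    (hc : RingDer.IsInnerBy (δ.polyApply (X ^ p - C a * X)) c)
    (hδc : δ c = 0)
    -- `f` is monic of degree `m ≥ 1`
    (f : DiffPoly δ) (m : ℕ) (hf : f.Monic) (hm : f.natDegree = m) (hm1 : 1 ≤ m)
    -- `h = ĥ(g(t) - c)` is the minimal central left multiple of `f`, and `ĥ` is irreducible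
    (h : DiffPoly δ) (hhat : (δ.centralConstants)[X])
    (hh : IsMinimalCentralLeftMultiple
      (aeval (t δ) (X ^ p - C a * X : (δ.centralConstants)[X]) - const δ c) f h hhat)
    (hirr : Irreducible hhat) :
    (IsGeneralisedAPolynomial f ↔
      (∃ b : δ.centralConstants,
        f = h ∧ h = t δ ^ p - const δ a * t δ - const δ (b + c) ∧
        ∀ α : D, V δ p α - a * α - (b + c) ≠ 0) ∨
      (∃ b : δ.centralConstants,
        h = t δ ^ p - const δ a * t δ - const δ (b + c) ∧ m ≤ p ∧
        ∃ (v : Fin m → D) (α : D),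
          (∀ i, v i ≠ 0) ∧ (∀ i : Fin m, (i : ℕ) + 1 = m → v i = 1) ∧
          f = (List.ofFn fun i => t δ - const δ (Omega δ (v i) α)).prod ∧
          V δ p α - a * α - (b + c) = 0)) ∧
    (∀ b : δ.centralConstants,
      f = h → h = t δ ^ p - const δ a * t δ - const δ (b + c) →
      (∀ α : D, V δ p α - a * α - (b + c) ≠ 0) → Irreducible f) := by
  have hp : p.Prime := Fact.out
  have hcx : ∀ x, δ^[p] x - a * δ x = c * x - x * c := fun x => by
    rw [← RingDer.polyApply_X_pow_sub_C_mul_X]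
    exact hc x
  have hδ : ∀ q ∈ Subring.center (DiffPoly δ), degree q < p →
      ∃ b : δ.centralConstants, q = const δ b := fun q hq hd =>
    exists_eq_const_of_mem_center p (fun r hr e => hg.not_inner hp.one_lt hr e) hq hd
  have hfin : Module.Finite δ.centralConstants D :=
    -- On the centre `[c, x] = 0`, so `δ^p = aδ` there: the Wronskian argument runs with `n = p` and
    -- `k = 1`.
    δ.finite_centralConstants hp.one_lt (a : D) fun x hx => by
      have h1 := hcx x
      rwa [Subring.mem_center_iff.mp hx, sub_self, sub_eq_zero] at h1
  have hzc : ∀ b : δ.centralConstants, t δ ^ p - const δ a * t δ - const δ (b + c) ∈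
      Subring.center (DiffPoly δ) := t_pow_sub_mem_center hcx hδc
  have hf1 : 1 ≤ f.natDegree := hm ▸ hm1
  have h1f := one_notMem_span hf1
  have hhf : h ∈ Ideal.span {f} := by
    obtain ⟨q, hq⟩ := hh.left_multiple
    exact Ideal.mem_span_singleton'.mpr ⟨q, hq.symm⟩
  have hgap : ∀ b : δ.centralConstants, h = t δ ^ p - const δ a * t δ - const δ (b + c) →
      IsGeneralisedAPolynomial f := fun b hb =>
    isGeneralisedAPolynomial_of_mem_span (h := h) (hb ▸ hzc b)
      (hb ▸ (degree_t_pow_sub p a _).1) hδ h1f hhf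
  have hsimple : ∀ b : δ.centralConstants, h = t δ ^ p - const δ a * t δ - const δ (b + c) →
      (∀ α : D, V δ p α - a * α - (b + c) ≠ 0) → ∀ g : DiffPoly δ, g.Monic → 1 ≤ natDegree g →
      h ∈ Ideal.span {g} → natDegree g = natDegree h := by
    intro b hb hroot g hgm hg1 hhg
    have hd : degree h = p := hb ▸ (degree_t_pow_sub p a _).1
    have hhm : h.Monic := hb ▸ (degree_t_pow_sub p a _).2
    have hnd : natDegree h = p := by
      rw [degree_eq_natDegree' hhm.ne_zero'] at hd
      exact_mod_cast hd
    rw [hnd]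
    refine natDegree_eq_of_forall_notMem_span (hb ▸ hzc b) hd hδ hp hhm (fun α hα => ?_) hgm hg1 hhg
    rw [hb, t_pow_sub_mem_span_iff] at hα
    exact hroot α hα
  refine ⟨⟨fun hGA => ?_, ?_⟩, ?_⟩
  · have hcentral := hGA.isCentral
    have hz : aeval (t δ) (X ^ p - C a * X : (δ.centralConstants)[X]) - const δ c ∈
        Subring.center (DiffPoly δ) := by
      have h0 := hzc 0
      rwa [← aeval_t_X_pow_sub, map_zero, sub_zero] at h0
    obtain ⟨b, hb⟩ := exists_sub_algebraMap_mem_span (k := δ.centralConstants) (f := f) hz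
    have hhat_eq := eq_X_sub_C_of_aeval_mem h1f hb hh.monic hirr (hh.eq_aeval ▸ hhf)
    have hb' : h = t δ ^ p - const δ a * t δ - const δ (b + c) := by
      rw [← aeval_t_X_pow_sub, hh.eq_aeval, hhat_eq, map_sub (aeval _), aeval_X, aeval_C]
    have hd : degree h = p := hb' ▸ (degree_t_pow_sub p a _).1
    have hhm : h.Monic := hb' ▸ (degree_t_pow_sub p a _).2
    -- The two cases are whether or not `h` has a linear right factor.
    by_cases hroot : ∀ α : D, V δ p α - a * α - (b + c) ≠ 0
    · exact Or.inl ⟨b, eq_of_mem_span_of_natDegree_eq hf hhm hhf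
        (hsimple b hb' hroot f hf hf1 hhf), hb', hroot⟩
    · push Not at hroot
      obtain ⟨α₀, hα₀⟩ := hroot
      rw [← t_pow_sub_mem_span_iff, ← hb'] at hα₀
      obtain ⟨v, α, hv0, hv1, hfv, hα⟩ :=
        exists_eq_prod_ofFn (hb' ▸ hzc b) hd hδ hα₀ hm1 hf hm hhf
      rw [hb', t_pow_sub_mem_span_iff] at hα
      refine Or.inr ⟨b, hb', ?_, v, α, hv0, hv1, hfv, hα⟩
      obtain ⟨q, hq⟩ := Ideal.mem_span_singleton'.mp hhf
      have hq0 : q ≠ 0 := by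
        rintro rfl
        exact hhm.ne_zero' (by rw [← hq, zero_mul])
      have hdeg := (natDegree_mul' hq0 hf.ne_zero').2
      rw [degree_eq_natDegree' hhm.ne_zero'] at hd
      have hnd : natDegree h = p := by exact_mod_cast hd
      rw [hq] at hdeg
      omega
  · rintro (⟨b, -, hb, -⟩ | ⟨b, hb, -⟩)
    · exact hgap b hb
    · exact hgap b hb
  · intro b hfh hb hroot
    refine irreducible_of_natDegree_eq hf1 fun g hgm hg1 hfg => ?_
    rw [hfh] at hfg ⊢
    exact hsimple b hb hroot g hgm hg1 hfg
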